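/- Fix an integer $\ell \ge 2$. Consider the following range $\ell$-clique counting problem: $G = (V, E)$ is a finite simple undirected graph with $m = |E|$ edges in which each vertex $v$ carries a real-valued attribute $A_v$; given an interval $q = [x_1, x_2]$ with real endpoints, a query returns the number of $\ell$-cliques (subgraphs isomorphic to the complete graph on $\ell$ vertices) in the subgraph of $G$ induced by the vertices $v$ with $x_1 \le A_v \le x_2$. For this problem there is a data structure that occupies $O(m)$ memory cells and answers every query in $\tilde{O}(1)$ time. Here the machine is a word RAM in which a memory cell holds either a word of $w$ bits, for any $w \ge c \lfloor \log_2 (m+2) \rfloor$, or a real number, which can only be copied and compared; each atomic operation (arithmetic or bitwise operation on words, comparison, access to a memory cell) takes one unit of time. More precisely, there are a query program and constants $c, C, k$, depending only on $\ell$, such that for all $G$, $A$ and $w$ as above some content of at most $C \cdot m$ memory cells lets the program answer every query in at most $C \lfloor \log_2 (m+2) \rfloor^k$ units of time (with the memory restored at the end of the query). -/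

import Mathlib

/-! ## Range subgraph counting -/

/-- The vertices whose attribute lies in the interval `[x₁, x₂]`. -/
def rangeVerts {V : Type*} (A : V → ℝ) (x₁ x₂ : ℝ) : Set V :=
  {v | x₁ ≤ A v ∧ A v ≤ x₂}

open Classical in
/-- The number of occurrences of the pattern `Q` (subgraphs isomorphic to `Q`) in the subgraph of
`G` induced by the vertices whose attribute lies in `[x₁, x₂]`. -/
noncomputable def rangeCount {V W : Type*} [Fintype V] (G : SimpleGraph V) (A : V → ℝ)
    (Q : SimpleGraph W) (x₁ x₂ : ℝ) : ℕ :=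
  (G.induce (rangeVerts A x₁ x₂)).copyCount Q

/-! ## The machine

A word RAM with words of `w` bits. Besides words it handles real numbers (attribute values and
interval endpoints), but as indivisible objects: they occupy cells of their own and can only be
copied and compared with each other. Every atomic operation and every evaluated test costs one
unit of time. -/

namespace RAM

/-- The binary operations on words. Arithmetic is modulo `2 ^ w`. -/
inductive BinOp
  | add | sub | mul | div | mod | and | or | xor | shl | shr

/-- The value of a binary operation (division by zero returns `0`, and `a mod 0 = a`). -/
def BinOp.eval {w : ℕ} : BinOp → BitVec w → BitVec w → BitVec w
  | .add, a, b => a + b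
  | .sub, a, b => a - b
  | .mul, a, b => a * b
  | .div, a, b => a / b
  | .mod, a, b => a % b
  | .and, a, b => a &&& b
  | .or, a, b => a ||| b
  | .xor, a, b => a ^^^ b
  | .shl, a, b => a <<< b
  | .shr, a, b => a >>> b

/-- A configuration: word registers, word memory, real registers and real memory. Memory cells are
addressed by words; a program mentions only finitely many registers. -/
structure State (w : ℕ) where
  reg : ℕ → BitVec w
  mem : BitVec w → BitVec w
  rreg : ℕ → ℝ
  rmem : BitVec w → ℝ

/-- Atomic instructions; `d`, `a`, `b` are register numbers. -/
inductive Instr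
  /-- write the constant `c` (modulo `2 ^ w`) to register `d` -/
  | const (d c : ℕ)
  /-- copy register `a` to register `d` -/
  | move (d a : ℕ)
  /-- write the result of an operation on registers `a`, `b` to register `d` -/
  | op (o : BinOp) (d a b : ℕ)
  /-- read the memory cell whose address is in register `a` into register `d` -/
  | load (d a : ℕ)
  /-- write register `b` to the memory cell whose address is in register `a` -/
  | store (a b : ℕ)
  /-- copy real register `a` to real register `d` -/
  | moveR (d a : ℕ)
  /-- read the real memory cell whose address is in word register `a` into real register `d` -/
  | loadR (d a : ℕ)
  /-- write real register `b` to the real memory cell whose address is in word register `a` -/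
  | storeR (a b : ℕ)

/-- The effect of an atomic instruction. -/
def Instr.exec {w : ℕ} : Instr → State w → State w
  | .const d c, s => { s with reg := Function.update s.reg d (BitVec.ofNat w c) }
  | .move d a, s => { s with reg := Function.update s.reg d (s.reg a) }
  | .op o d a b, s => { s with reg := Function.update s.reg d (o.eval (s.reg a) (s.reg b)) }
  | .load d a, s => { s with reg := Function.update s.reg d (s.mem (s.reg a)) }
  | .store a b, s => { s with mem := Function.update s.mem (s.reg a) (s.reg b) }
  | .moveR d a, s => { s with rreg := Function.update s.rreg d (s.rreg a) }
  | .loadR d a, s => { s with rreg := Function.update s.rreg d (s.rmem (s.reg a)) }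
  | .storeR a b, s => { s with rmem := Function.update s.rmem (s.reg a) (s.rreg b) }

/-- Tests: comparisons of two word registers (as unsigned numbers) or of two real registers. -/
inductive Test
  | eq (a b : ℕ)
  | lt (a b : ℕ)
  | leR (a b : ℕ)

/-- The truth of a test in a configuration. -/
def Test.holds {w : ℕ} : Test → State w → Prop
  | .eq a b, s => s.reg a = s.reg b
  | .lt a b, s => (s.reg a).toNat < (s.reg b).toNat
  | .leR a b, s => s.rreg a ≤ s.rreg b

/-- Programs. -/
inductive Prog
  | skip
  | instr (i : Instr)
  | seq (p q : Prog)
  | ite (b : Test) (p q : Prog)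
  | loop (b : Test) (p : Prog)

/-- `Run p s t s'`: started in configuration `s`, the program `p` halts in configuration `s'` after
exactly `t` units of time. -/
inductive Run {w : ℕ} : Prog → State w → ℕ → State w → Prop
  | skip (s : State w) : Run .skip s 1 s
  | instr (i : Instr) (s : State w) : Run (.instr i) s 1 (i.exec s)
  | seq {p q : Prog} {s s' s'' : State w} {t t' : ℕ} :
      Run p s t s' → Run q s' t' s'' → Run (.seq p q) s (t + t') s''
  | ite_true {b : Test} {p q : Prog} {s s' : State w} {t : ℕ} :
      b.holds s → Run p s t s' → Run (.ite b p q) s (t + 1) s'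
  | ite_false {b : Test} {p q : Prog} {s s' : State w} {t : ℕ} :
      ¬ b.holds s → Run q s t s' → Run (.ite b p q) s (t + 1) s'
  | loop_true {b : Test} {p : Prog} {s s' s'' : State w} {t t' : ℕ} :
      b.holds s → Run p s t s' → Run (.loop b p) s' t' s'' →
        Run (.loop b p) s (t + t' + 1) s''
  | loop_false {b : Test} {p : Prog} {s : State w} :
      ¬ b.holds s → Run (.loop b p) s 1 s

/-- The stored content of a data structure: words and real numbers, one per memory cell. -/
structure Store (w : ℕ) where
  words : List (BitVec w)
  reals : List ℝ

/-- The space of a data structure: the number of memory cells it occupies. -/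
def Store.space {w : ℕ} (D : Store w) : ℕ := D.words.length + D.reals.length

/-- The configuration at the start of a query with interval `[x₁, x₂]`: the structure occupies the
first cells of the two memories, the endpoints are in the real registers `0` and `1`, and everything
else is `0`. -/
noncomputable def Store.init {w : ℕ} (D : Store w) (x₁ x₂ : ℝ) : State w where
  reg := fun _ => 0
  mem := fun a => D.words.getD a.toNat 0
  rreg := fun i => if i = 0 then x₁ else if i = 1 then x₂ else 0
  rmem := fun a => D.reals.getD a.toNat 0

/-- On the structure `D`, the program `p` answers the query `[x₁, x₂]` within `T` units of time with
the number `ans`, left in word register `0`. The memory is as before when the query ends, so that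
the structure can be queried again. -/
def Answers {w : ℕ} (p : Prog) (D : Store w) (x₁ x₂ : ℝ) (T ans : ℕ) : Prop :=
  ∃ (t : ℕ) (s : State w), t ≤ T ∧ Run p (D.init x₁ x₂) t s ∧ (s.reg 0).toNat = ans ∧
    s.mem = (D.init x₁ x₂).mem ∧ s.rmem = (D.init x₁ x₂).rmem

end RAM

/-! A clique on at least two vertices contains an edge that joins a vertex of least attribute to a
vertex of greatest attribute. Assign each `l`-clique to one such edge, and let the weight of an edge
be the number of cliques assigned to it. A clique lies in the query range exactly when the interval
spanned by its edge does (`SimpleGraph.IsNClique.exists_spanning_edge`). So the answer is the total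
weight of those of `m` fixed intervals that are contained in `[x₁, x₂]` (`exists_intervals`). All
sums fit in a word, since there are at most `(2m)^l` cliques (`SimpleGraph.card_cliques_le`).

Sort the intervals by left endpoint and replace right endpoints by ranks. Two binary searches
translate `x₁` and `x₂` into counts `c₁` and `c₂`, and the answer becomes a difference of two
weighted dominance sums (`sum_drop_filter`, `below_points`).

These sums come from a wavelet tree in matrix form: each level is the stable partition of the whole
previous level by one key bit, the most significant first. A prefix followed through the levels also
collects points from other branches, but the resulting error does not depend on the prefix and
cancels in differences (`walk_add_below`).

For linear space, each of about `H = log m` levels is cut into blocks of `H` points. A block stores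
four words: the two places to which its start moves, its bits packed into one word, and the prefix
weight at its start. Single weights are stored on the bottom level only; elsewhere a weight is read
by following the point down. A step costs `O(H)`, a weight `O(H²)`, a prefix weight `O(H³)` and a
walk `O(H⁴)` (`wp_step`, `wp_weight`, `wp_psum`, `wp_walk`); `exists_store` fixes the parameters. -/

/-! ## A program logic with time bounds -/

namespace RAM

/-- The word stored at address `a` of a structure, as a number. -/
def Store.word {w : ℕ} (D : Store w) (a : ℕ) : ℕ := (D.words.getD a 0).toNat

/-- The configuration `s` occurs in a query of `D` with `[x₁, x₂]` that has left the memory as it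
was, and its word registers hold the numbers `v` (modulo `2 ^ w`). -/
structure Holds {w : ℕ} (D : Store w) (x₁ x₂ : ℝ) (v : ℕ → ℕ) (s : State w) : Prop where
  reg : ∀ i, s.reg i = BitVec.ofNat w (v i)
  mem : s.mem = (D.init x₁ x₂).mem
  rmem : s.rmem = (D.init x₁ x₂).rmem
  left : s.rreg 0 = x₁
  right : s.rreg 1 = x₂

/-- Started with the register contents `v`, the program `p` halts within `T` units of time with
register contents that satisfy `Q`, and leaves the memory as it was. -/
def Wp {w : ℕ} (D : Store w) (x₁ x₂ : ℝ) (p : Prog) (T : ℕ) (Q : (ℕ → ℕ) → Prop)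
    (v : ℕ → ℕ) : Prop :=
  ∀ s, Holds D x₁ x₂ v s →
    ∃ (t : ℕ) (s' : State w) (v' : ℕ → ℕ), t ≤ T ∧ Run p s t s' ∧ Holds D x₁ x₂ v' s' ∧ Q v'

/-- The operations on words used here, on numbers. -/
def BinOp.nat : BinOp → ℕ → ℕ → ℕ
  | .add, a, b => a + b
  | .sub, a, b => a - b
  | .mul, a, b => a * b
  | .div, a, b => a / b
  | .mod, a, b => a % b
  | _, _, _ => 0

/-- A condition under which an operation on words computes the operation on numbers. -/
def BinOp.Safe (w : ℕ) : BinOp → ℕ → ℕ → Prop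
  | .add, _, _ => True
  | .sub, a, b => b ≤ a
  | .mul, _, _ => True
  | .div, a, b => a < 2 ^ w ∧ b < 2 ^ w
  | .mod, a, b => a < 2 ^ w ∧ b < 2 ^ w
  | _, _, _ => False

/-- Reduction modulo `2 ^ w` respects sums, products and nonnegative differences, so these need no
size bound. Only division and remainder depend on the representatives. -/
theorem BinOp.eval_ofNat {w : ℕ} (o : BinOp) {a b : ℕ} (h : o.Safe w a b) :
    o.eval (BitVec.ofNat w a) (BitVec.ofNat w b) = BitVec.ofNat w (o.nat a b) := by
  cases o <;> simp only [BinOp.Safe] at h <;> simp only [BinOp.eval, BinOp.nat]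
  · rw [BitVec.ofNat_add]
  · have : BitVec.ofNat w a = BitVec.ofNat w (a - b) + BitVec.ofNat w b := by
      rw [← BitVec.ofNat_add, Nat.sub_add_cancel h]
    rw [this, add_sub_cancel_right]
  · rw [BitVec.ofNat_mul]
  · apply BitVec.eq_of_toNat_eq
    rw [BitVec.toNat_udiv, BitVec.toNat_ofNat, BitVec.toNat_ofNat, BitVec.toNat_ofNat,
      Nat.mod_eq_of_lt h.1, Nat.mod_eq_of_lt h.2,
      Nat.mod_eq_of_lt ((Nat.div_le_self _ _).trans_lt h.1)]
  · apply BitVec.eq_of_toNat_eq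
    rw [BitVec.toNat_umod, BitVec.toNat_ofNat, BitVec.toNat_ofNat, BitVec.toNat_ofNat,
      Nat.mod_eq_of_lt h.1, Nat.mod_eq_of_lt h.2,
      Nat.mod_eq_of_lt ((Nat.mod_le _ _).trans_lt h.1)]

/-- The sequence of instructions `is` as a program. -/
def block : List Instr → Prog
  | [] => .skip
  | i :: is => .seq (.instr i) (block is)

/-- A sufficient condition for `block is` to establish `Q` from `v`. -/
def Block {w : ℕ} (D : Store w) : List Instr → ((ℕ → ℕ) → Prop) → (ℕ → ℕ) → Prop
  | [], Q, v => Q v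
  | .const d c :: is, Q, v => Block D is Q (Function.update v d c)
  | .move d a :: is, Q, v => Block D is Q (Function.update v d (v a))
  | .op o d a b :: is, Q, v =>
      o.Safe w (v a) (v b) ∧ Block D is Q (Function.update v d (o.nat (v a) (v b)))
  | .load d a :: is, Q, v => v a < 2 ^ w ∧ Block D is Q (Function.update v d (D.word (v a)))
  | _ :: _, _, _ => False

variable {w : ℕ} {D : Store w} {x₁ x₂ : ℝ}

theorem Holds.update {v : ℕ → ℕ} {s : State w} (h : Holds D x₁ x₂ v s) (d n : ℕ) :
    Holds D x₁ x₂ (Function.update v d n)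
      { s with reg := Function.update s.reg d (BitVec.ofNat w n) } where
  reg i := by
    by_cases hi : i = d
    · subst hi; simp
    · simp [hi, h.reg i]
  mem := h.mem
  rmem := h.rmem
  left := h.left
  right := h.right

theorem Wp.mono {p : Prog} {T T' : ℕ} {Q Q' : (ℕ → ℕ) → Prop} {v : ℕ → ℕ}
    (h : Wp D x₁ x₂ p T Q v) (hT : T ≤ T') (hQ : ∀ v', Q v' → Q' v') :
    Wp D x₁ x₂ p T' Q' v := fun s hs =>
  let ⟨t, s', v', ht, hr, hs', hq⟩ := h s hs
  ⟨t, s', v', ht.trans hT, hr, hs', hQ _ hq⟩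

theorem Wp.skip {Q : (ℕ → ℕ) → Prop} {v : ℕ → ℕ} (h : Q v) : Wp D x₁ x₂ .skip 1 Q v :=
  fun s hs => ⟨1, s, v, le_rfl, .skip s, hs, h⟩

theorem Wp.seq {p q : Prog} {T T' : ℕ} {Q : (ℕ → ℕ) → Prop} {v : ℕ → ℕ}
    (h : Wp D x₁ x₂ p T (Wp D x₁ x₂ q T' Q) v) : Wp D x₁ x₂ (.seq p q) (T + T') Q v :=
  fun s hs =>
    let ⟨_, _, _, ht, hr, hs', hq⟩ := h s hs
    let ⟨_, s'', v'', ht', hr', hs'', hq'⟩ := hq _ hs'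
    ⟨_, s'', v'', Nat.add_le_add ht ht', .seq hr hr', hs'', hq'⟩

theorem Wp.instr {i : Instr} {Q : (ℕ → ℕ) → Prop} {v : ℕ → ℕ} (h : Block D [i] Q v) :
    Wp D x₁ x₂ (.instr i) 1 Q v := by
  intro s hs
  cases i with
  | const d c => exact ⟨1, _, _, le_rfl, .instr _ s, hs.update d c, h⟩
  | move d a =>
    refine ⟨1, _, _, le_rfl, .instr _ s, ?_, h⟩
    simpa only [Instr.exec, hs.reg a] using hs.update d (v a)
  | op o d a b =>
    refine ⟨1, _, _, le_rfl, .instr _ s, ?_, h.2⟩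
    simpa only [Instr.exec, hs.reg a, hs.reg b, o.eval_ofNat h.1] using
      hs.update d (o.nat (v a) (v b))
  | load d a =>
    refine ⟨1, _, _, le_rfl, .instr _ s, ?_, h.2⟩
    have e : s.mem (s.reg a) = BitVec.ofNat w (D.word (v a)) := by
      rw [hs.mem, hs.reg a]
      simp [Store.init, Store.word, Nat.mod_eq_of_lt h.1]
    simpa only [Instr.exec, e] using hs.update d (D.word (v a))
  | store a b => exact h.elim
  | moveR d a => exact h.elim
  | loadR d a => exact h.elim
  | storeR a b => exact h.elim

theorem Wp.block {is : List Instr} {Q : (ℕ → ℕ) → Prop} {v : ℕ → ℕ} (h : Block D is Q v) :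
    Wp D x₁ x₂ (block is) (is.length + 1) Q v := by
  induction is generalizing v with
  | nil => exact .skip h
  | cons i is ih =>
    have : Wp D x₁ x₂ (.instr i) 1 (Block D is Q) v := by
      apply Wp.instr
      cases i <;> exact h
    refine (Wp.seq (this.mono le_rfl fun v' hv' => ih hv')).mono ?_ fun _ h => h
    simp only [List.length_cons]; omega

theorem Holds.toNat_reg {v : ℕ → ℕ} {s : State w} (h : Holds D x₁ x₂ v s) {a : ℕ}
    (ha : v a < 2 ^ w) : (s.reg a).toNat = v a := by
  rw [h.reg a, BitVec.toNat_ofNat, Nat.mod_eq_of_lt ha]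

theorem Wp.ite {b : Test} {B : Prop} {p q : Prog} {T : ℕ} {Q : (ℕ → ℕ) → Prop} {v : ℕ → ℕ}
    (hb : ∀ s, Holds D x₁ x₂ v s → (b.holds s ↔ B)) (hp : B → Wp D x₁ x₂ p T Q v)
    (hq : ¬ B → Wp D x₁ x₂ q T Q v) : Wp D x₁ x₂ (.ite b p q) (T + 1) Q v := by
  intro s hs
  by_cases h : B
  · obtain ⟨t, s', v', ht, hr, h'⟩ := hp h s hs
    exact ⟨t + 1, s', v', by omega, .ite_true ((hb s hs).2 h) hr, h'⟩
  · obtain ⟨t, s', v', ht, hr, h'⟩ := hq h s hs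
    exact ⟨t + 1, s', v', by omega, .ite_false (fun h' => h ((hb s hs).1 h')) hr, h'⟩

theorem Holds.lt_iff {v : ℕ → ℕ} {s : State w} (h : Holds D x₁ x₂ v s) {a b : ℕ}
    (ha : v a < 2 ^ w) (hb : v b < 2 ^ w) : (Test.lt a b).holds s ↔ v a < v b := by
  rw [Test.holds, h.toNat_reg ha, h.toNat_reg hb]

theorem Wp.ite_lt {a b : ℕ} {p q : Prog} {T : ℕ} {Q : (ℕ → ℕ) → Prop} {v : ℕ → ℕ}
    (ha : v a < 2 ^ w) (hb : v b < 2 ^ w) (hp : v a < v b → Wp D x₁ x₂ p T Q v)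
    (hq : ¬ v a < v b → Wp D x₁ x₂ q T Q v) : Wp D x₁ x₂ (.ite (.lt a b) p q) (T + 1) Q v :=
  .ite (fun _ hs => hs.lt_iff ha hb) hp hq

theorem Wp.ite_eq {a b : ℕ} {p q : Prog} {T : ℕ} {Q : (ℕ → ℕ) → Prop} {v : ℕ → ℕ}
    (ha : v a < 2 ^ w) (hb : v b < 2 ^ w) (hp : v a = v b → Wp D x₁ x₂ p T Q v)
    (hq : ¬ v a = v b → Wp D x₁ x₂ q T Q v) : Wp D x₁ x₂ (.ite (.eq a b) p q) (T + 1) Q v := by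
  refine .ite (fun s hs => ?_) hp hq
  rw [Test.holds, ← BitVec.toNat_inj, hs.toNat_reg ha, hs.toNat_reg hb]

/-- A loop governed by a comparison of two registers, run exactly `n` times. -/
theorem Wp.loop_lt {a b : ℕ} {p : Prog} {T : ℕ} {Q : (ℕ → ℕ) → Prop} {v : ℕ → ℕ} (n : ℕ)
    (I : ℕ → (ℕ → ℕ) → Prop) (h0 : I 0 v) (hw : ∀ k v, k ≤ n → I k v → v a < 2 ^ w ∧ v b < 2 ^ w)
    (hstep : ∀ k v, k < n → I k v → v a < v b ∧ Wp D x₁ x₂ p T (I (k + 1)) v)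
    (hend : ∀ v, I n v → v b ≤ v a ∧ Q v) :
    Wp D x₁ x₂ (.loop (.lt a b) p) (n * (T + 1) + 1) Q v := by
  -- Induction on the number `j` of rounds still to run; `k` rounds are done.
  suffices h : ∀ j k v, k + j = n → I k v →
      Wp D x₁ x₂ (.loop (.lt a b) p) (j * (T + 1) + 1) Q v from h n 0 v (zero_add n) h0
  intro j
  induction j with
  | zero =>
    intro k v hk hI s hs
    obtain rfl : k = n := by omega
    obtain ⟨ha, hb⟩ := hw _ v le_rfl hI
    refine ⟨1, s, v, by simp, .loop_false ?_, hs, (hend v hI).2⟩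
    rw [hs.lt_iff ha hb]
    exact not_lt.2 (hend v hI).1
  | succ j ih =>
    intro k v hk hI s hs
    obtain ⟨ha, hb⟩ := hw k v (by omega) hI
    obtain ⟨hlt, hp⟩ := hstep k v (by omega) hI
    obtain ⟨t, s', v', ht, hr, hs', hI'⟩ := hp s hs
    obtain ⟨t', s'', v'', ht', hr', h''⟩ := ih (k + 1) v' (by omega) hI' s' hs'
    exact ⟨t + t' + 1, s'', v'', by linarith, .loop_true ((hs.lt_iff ha hb).2 hlt) hr hr', h''⟩

/-- Loading the real number at the address in register `a` into real register `2`. -/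
theorem Wp.loadR_ite {a : ℕ} {b : Test} {B : Prop} {p q : Prog} {T : ℕ} {Q : (ℕ → ℕ) → Prop}
    {v : ℕ → ℕ} (ha : v a < 2 ^ w)
    (hb : ∀ s : State w, s.rreg 0 = x₁ → s.rreg 1 = x₂ → s.rreg 2 = D.reals.getD (v a) 0 →
      (b.holds s ↔ B))
    (hp : B → Wp D x₁ x₂ p T Q v) (hq : ¬ B → Wp D x₁ x₂ q T Q v) :
    Wp D x₁ x₂ (.seq (.instr (.loadR 2 a)) (.ite b p q)) (T + 2) Q v := by
  intro s hs
  -- `Holds` says nothing about real register `2`, so the load preserves it; for the same reason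
  -- load and test are treated together.
  have hs' : Holds D x₁ x₂ v ((Instr.loadR 2 a).exec s) :=
    ⟨hs.reg, hs.mem, hs.rmem, by simp [Instr.exec, hs.left], by simp [Instr.exec, hs.right]⟩
  have hB : b.holds ((Instr.loadR 2 a).exec s) ↔ B := by
    apply hb _ hs'.left hs'.right
    simp [Instr.exec, hs.rmem, hs.reg a, Store.init, Nat.mod_eq_of_lt ha]
  have hr := Run.instr (Instr.loadR 2 a) s
  by_cases h : B
  · obtain ⟨t, s', v', ht, hr', h'⟩ := hp h _ hs'
    exact ⟨1 + (t + 1), s', v', by omega, .seq hr (.ite_true (hB.2 h) hr'), h'⟩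
  · obtain ⟨t, s', v', ht, hr', h'⟩ := hq h _ hs'
    exact ⟨1 + (t + 1), s', v', by omega, .seq hr (.ite_false (fun h' => h (hB.1 h')) hr'), h'⟩

theorem Holds.init : Holds D x₁ x₂ 0 (D.init x₁ x₂) where
  reg i := by simp [Store.init]
  mem := rfl
  rmem := rfl
  left := by simp [Store.init]
  right := by simp [Store.init]

theorem Wp.answers {p : Prog} {T ans : ℕ} (hans : ans < 2 ^ w)
    (h : Wp D x₁ x₂ p T (fun v => v 0 = ans) 0) : Answers p D x₁ x₂ T ans := by
  obtain ⟨t, s, v, ht, hr, hs, hv⟩ := h _ .init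
  exact ⟨t, s, ht, hr, by rw [hs.toNat_reg (hv ▸ hans), hv], hs.mem, hs.rmem⟩

end RAM

/-! ## Wavelet trees of weighted points

A point is a pair of a key and a weight. -/

namespace Wavelet

/-- Bit `h` of the key. -/
abbrev bit (h : ℕ) (e : ℕ × ℕ) : Bool := e.1.testBit h

/-- The stable partition of a list by bit `h` of the keys. -/
def part (h : ℕ) (L : List (ℕ × ℕ)) : List (ℕ × ℕ) :=
  L.filter (fun e => !bit h e) ++ L.filter (bit h)

/-- The place after the partition of a point with bit `0` at place `p`. -/
def lo (h : ℕ) (L : List (ℕ × ℕ)) (p : ℕ) : ℕ := (L.take p).countP fun e => !bit h e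

/-- The place after the partition of a point with bit `1` at place `p`. -/
def hi (h : ℕ) (L : List (ℕ × ℕ)) (p : ℕ) : ℕ :=
  (L.countP fun e => !bit h e) + (L.take p).countP (bit h)

/-- The total weight of the first `p` points. -/
def psum (L : List (ℕ × ℕ)) (p : ℕ) : ℕ := ((L.take p).map Prod.snd).sum

/-- The total weight of those of the first `p` points whose keys are below `b` modulo `2 ^ h`. -/
def below (h b : ℕ) (L : List (ℕ × ℕ)) (p : ℕ) : ℕ :=
  (((L.take p).filter fun e => decide (e.1 % 2 ^ h < b)).map Prod.snd).sum

/-- The sum accumulated on the way down the tree. -/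
def walk : ℕ → ℕ → List (ℕ × ℕ) → ℕ → ℕ
  | 0, _, _, _ => 0
  | h + 1, b, L, p =>
    if b < 2 ^ h then walk h b (part h L) (lo h L p)
    else psum (part h L) (lo h L p) + walk h (b - 2 ^ h) (part h L) (hi h L p)

/-- The levels of the tree for keys of `H` bits. -/
def level (H : ℕ) (L : List (ℕ × ℕ)) : ℕ → List (ℕ × ℕ)
  | 0 => L
  | j + 1 => part (H - 1 - j) (level H L j)

/-- The number whose binary digits are the bits `h` of `r` points from place `p` on. -/
def bits (h : ℕ) (L : List (ℕ × ℕ)) (p r : ℕ) : ℕ :=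
  Nat.ofDigits 2 (((L.drop p).take r).map fun e => (bit h e).toNat)

/-! ### Places and prefixes under the stable partition -/

theorem part_perm (h : ℕ) (L : List (ℕ × ℕ)) : (part h L).Perm L := by
  refine List.Perm.trans List.perm_append_comm ?_
  exact List.filter_append_perm (bit h) L

@[simp] theorem length_part (h : ℕ) (L : List (ℕ × ℕ)) : (part h L).length = L.length :=
  (part_perm h L).length_eq

theorem level_perm (H : ℕ) (L : List (ℕ × ℕ)) (j : ℕ) : (level H L j).Perm L := by
  induction j with
  | zero => exact .refl _
  | succ j ih => exact (part_perm _ _).trans ih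

@[simp] theorem length_level (H : ℕ) (L : List (ℕ × ℕ)) (j : ℕ) :
    (level H L j).length = L.length :=
  (level_perm H L j).length_eq

/-- Filtering keeps the order, so prefixes go to prefixes. This stability is what lets a prefix be
tracked through the levels by a single number. -/
theorem take_countP_filter {α : Type*} (q : α → Bool) (L : List α) (p : ℕ) :
    (L.filter q).take ((L.take p).countP q) = (L.take p).filter q := by
  conv_lhs => rw [← List.take_append_drop p L, List.filter_append]
  rw [List.take_append_drop, List.countP_eq_length_filter, List.take_left']
  rfl

theorem getElem?_countP_filter {α : Type*} {q : α → Bool} {L : List α} {p : ℕ} {e : α}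
    (he : L[p]? = some e) (hq : q e = true) :
    (L.filter q)[(L.take p).countP q]? = some e := by
  obtain ⟨hp, rfl⟩ := List.getElem?_eq_some_iff.1 he
  conv_lhs => rw [← List.take_append_drop p L, List.filter_append]
  rw [List.take_append_drop, List.countP_eq_length_filter, List.getElem?_append_right le_rfl,
    Nat.sub_self, List.drop_eq_getElem_cons hp, List.filter_cons_of_pos hq]
  rfl

theorem take_lo (h : ℕ) (L : List (ℕ × ℕ)) (p : ℕ) :
    (part h L).take (lo h L p) = (L.take p).filter fun e => !bit h e := by
  rw [part, lo, List.take_append_of_le_length, take_countP_filter]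
  rw [← List.countP_eq_length_filter]
  exact (List.take_sublist p L).countP_le

theorem take_hi (h : ℕ) (L : List (ℕ × ℕ)) (p : ℕ) :
    (part h L).take (hi h L p) =
      (L.filter fun e => !bit h e) ++ (L.take p).filter (bit h) := by
  rw [part, hi, List.countP_eq_length_filter (l := L), List.take_length_add_append,
    take_countP_filter]

/-- Lets a single point be followed down to the bottom level, where its weight is stored. -/
theorem getElem?_part {h : ℕ} {L : List (ℕ × ℕ)} {p : ℕ} {e : ℕ × ℕ} (he : L[p]? = some e) :
    (part h L)[if bit h e then hi h L p else lo h L p]? = some e := by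
  split_ifs with hb
  · rw [part, hi, List.countP_eq_length_filter (l := L), List.getElem?_append_right (by omega),
      Nat.add_sub_cancel_left]
    exact getElem?_countP_filter he hb
  · have h1 := getElem?_countP_filter (q := fun e => !bit h e) he (by simpa using hb)
    rw [part, lo, List.getElem?_append_left, h1]
    exact (List.getElem?_eq_some_iff.1 h1).1

theorem lo_le (h : ℕ) (L : List (ℕ × ℕ)) (p : ℕ) : lo h L p ≤ L.length :=
  ((List.take_sublist p L).countP_le).trans (List.countP_le_length)

theorem hi_le (h : ℕ) (L : List (ℕ × ℕ)) (p : ℕ) : hi h L p ≤ L.length := by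
  have h1 : (L.take p).countP (bit h) ≤ L.countP (bit h) := (List.take_sublist p L).countP_le
  have h2 := (part_perm h L).length_eq
  rw [part, List.length_append, ← List.countP_eq_length_filter,
    ← List.countP_eq_length_filter] at h2
  rw [hi]; omega

theorem lo_succ {h : ℕ} {L : List (ℕ × ℕ)} {p : ℕ} (hp : p < L.length) :
    lo h L (p + 1) = lo h L p + (1 - (bit h L[p]).toNat) := by
  rw [lo, lo, List.take_succ_eq_append_getElem hp, List.countP_append]
  cases hb : bit h L[p] <;> simp [hb]

theorem hi_succ {h : ℕ} {L : List (ℕ × ℕ)} {p : ℕ} (hp : p < L.length) :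
    hi h L (p + 1) = hi h L p + (bit h L[p]).toNat := by
  rw [hi, hi, List.take_succ_eq_append_getElem hp, List.countP_append, add_assoc]
  cases hb : bit h L[p] <;> simp [hb]

theorem psum_succ {L : List (ℕ × ℕ)} {p : ℕ} (hp : p < L.length) :
    psum L (p + 1) = psum L p + L[p].2 := by
  rw [psum, psum, List.take_succ_eq_append_getElem hp, List.map_append, List.sum_append]
  simp

theorem psum_le (L : List (ℕ × ℕ)) (p : ℕ) : psum L p ≤ (L.map Prod.snd).sum :=
  ((List.take_sublist p L).map Prod.snd).sum_le_sum (by simp)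

theorem below_mono (h b : ℕ) (L : List (ℕ × ℕ)) {p q : ℕ} (hpq : p ≤ q) :
    below h b L p ≤ below h b L q :=
  (((List.take_sublist_take_left hpq).filter _).map Prod.snd).sum_le_sum (by simp)

theorem bits_succ {h : ℕ} {L : List (ℕ × ℕ)} {p : ℕ} (hp : p < L.length) (r : ℕ) :
    bits h L p (r + 1) = (bit h L[p]).toNat + 2 * bits h L (p + 1) r := by
  rw [bits, bits, List.drop_eq_getElem_cons hp, List.take_succ_cons, List.map_cons,
    Nat.ofDigits_cons]

theorem bits_lt (h : ℕ) (L : List (ℕ × ℕ)) (p r : ℕ) : bits h L p r < 2 ^ r := by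
  refine (Nat.ofDigits_lt_base_pow_length one_lt_two fun x hx => ?_).trans_le
    (Nat.pow_le_pow_right two_pos ?_)
  · obtain ⟨e, -, rfl⟩ := List.mem_map.1 hx
    exact Bool.toNat_lt _
  · simp

/-! ### Dominance sums along a walk -/

theorem sum_filter_eq_add {L : List (ℕ × ℕ)} (q r : ℕ × ℕ → Bool) :
    ((L.filter r).map Prod.snd).sum = (((L.filter fun e => !q e).filter r).map Prod.snd).sum +
      (((L.filter q).filter r).map Prod.snd).sum := by
  rw [← List.sum_append, ← List.map_append, ← List.filter_append]
  exact (((List.perm_append_comm.trans (List.filter_append_perm q L)).filter r).map _).sum_eq.symm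

theorem mod_two_pow_succ_of_testBit_false {h y : ℕ} (hb : y.testBit h = false) :
    y % 2 ^ (h + 1) = y % 2 ^ h := by
  rw [Nat.testBit_eq_decide_div_mod_eq, decide_eq_false_iff_not] at hb
  rw [Nat.mod_pow_succ, Nat.mod_two_ne_one.1 hb, mul_zero, add_zero]

theorem mod_two_pow_succ_of_testBit_true {h y : ℕ} (hb : y.testBit h = true) :
    y % 2 ^ (h + 1) = y % 2 ^ h + 2 ^ h := by
  rw [Nat.testBit_eq_decide_div_mod_eq, decide_eq_true_eq] at hb
  rw [Nat.mod_pow_succ, hb, mul_one]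

/-- A point with bit `h` set has residue at least `2 ^ h > b` and never counts; the others in the
prefix form a prefix of the next level. -/
theorem below_succ_of_lt {h b : ℕ} (hb : b < 2 ^ h) (L : List (ℕ × ℕ)) (p : ℕ) :
    below (h + 1) b L p = below h b (part h L) (lo h L p) := by
  rw [below, below, take_lo, sum_filter_eq_add (bit h)]
  have h2 : ((L.take p).filter (bit h)).filter (fun e => decide (e.1 % 2 ^ (h + 1) < b)) = [] := by
    rw [List.filter_eq_nil_iff]
    intro e he
    have := mod_two_pow_succ_of_testBit_true (List.mem_filter.1 he).2
    simp only [decide_eq_true_eq]; omega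
  rw [h2, List.map_nil, List.sum_nil, add_zero]
  congr 2
  apply List.filter_congr
  intro e he
  rw [mod_two_pow_succ_of_testBit_false (by simpa using (List.mem_filter.1 he).2)]

/-- Every point of the prefix with bit `h` clear counts. Those with the bit set follow all the zeros
of `L` on the next level, so the prefix there contains these zeros too; the term at `hi h L 0`
accounts for them and is independent of `p`. -/
theorem below_succ_of_le {h b : ℕ} (hb : 2 ^ h ≤ b) (L : List (ℕ × ℕ)) (p : ℕ) :
    below (h + 1) b L p + below h (b - 2 ^ h) (part h L) (hi h L 0) =
      psum (part h L) (lo h L p) + below h (b - 2 ^ h) (part h L) (hi h L p) := by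
  rw [below, below, below, psum, take_lo, take_hi, take_hi, sum_filter_eq_add (bit h)]
  have h1 : ((L.take p).filter fun e => !bit h e).filter
      (fun e => decide (e.1 % 2 ^ (h + 1) < b)) = (L.take p).filter fun e => !bit h e := by
    rw [List.filter_eq_self]
    intro e he
    have := mod_two_pow_succ_of_testBit_false (h := h) (y := e.1)
      (by simpa using (List.mem_filter.1 he).2)
    have := Nat.mod_lt e.1 (Nat.two_pow_pos h)
    simp only [decide_eq_true_eq]; omega
  have h2 : ((L.take p).filter (bit h)).filter (fun e => decide (e.1 % 2 ^ (h + 1) < b)) =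
      ((L.take p).filter (bit h)).filter (fun e => decide (e.1 % 2 ^ h < b - 2 ^ h)) := by
    apply List.filter_congr
    intro e he
    have := mod_two_pow_succ_of_testBit_true (List.mem_filter.1 he).2
    rw [decide_eq_decide]; omega
  rw [h1, h2]
  simp only [List.take_zero, List.filter_nil, List.append_nil, List.filter_append, List.map_append,
    List.sum_append]
  ring

/-- Differences of walks are the weights of dominated points. -/
theorem walk_add_below (h : ℕ) : ∀ {b : ℕ}, b < 2 ^ h → ∀ (L : List (ℕ × ℕ)) (p q : ℕ),
    walk h b L p + below h b L q = walk h b L q + below h b L p := by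
  induction h with
  | zero =>
    intro b hb L p q
    obtain rfl : b = 0 := by simpa using hb
    simp [walk, below]
  | succ h ih =>
    intro b hb L p q
    rw [walk, walk]
    split_ifs with hlt
    · rw [below_succ_of_lt hlt, below_succ_of_lt hlt]
      exact ih hlt _ _ _
    -- The correction at `hi h L 0` is common to both identities, so it drops out.
    · have h1 := below_succ_of_le (not_lt.1 hlt) L p
      have h2 := below_succ_of_le (not_lt.1 hlt) L q
      have h3 := ih (b := b - 2 ^ h) (by rw [pow_succ] at hb; omega) (part h L) (hi h L p)
        (hi h L q)
      omega

end Wavelet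

/-! ## The query program -/

namespace RAM

open Wavelet

section rules

variable {w : ℕ} {D : Store w} {x₁ x₂ : ℝ}

/-- The registers below `k` agree. -/
def Frame (k : ℕ) (v v' : ℕ → ℕ) : Prop := ∀ i < k, v' i = v i

@[simp] theorem Frame.refl (k : ℕ) (v : ℕ → ℕ) : Frame k v v := fun _ _ => rfl

@[simp] theorem frame_update {k d : ℕ} (h : k ≤ d) (v v' : ℕ → ℕ) (n : ℕ) :
    Frame k v (Function.update v' d n) ↔ Frame k v v' := by
  refine forall₂_congr fun i hi => ?_
  rw [Function.update_of_ne (by omega)]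

/-- Subroutines use scratch registers of growing index: the walk, the prefix weight, the single
weight and the step preserve those below `10`, `22`, `32` and `42`. -/
theorem Frame.trans {k k' : ℕ} {v v' v'' : ℕ → ℕ} (h : Frame k v v') (h' : Frame k' v' v'')
    (hk : k ≤ k' := by norm_num) : Frame k v v'' :=
  fun i hi => (h' i (hi.trans_le hk)).trans (h i hi)

theorem Wp.comp {p q : Prog} {T T' T'' : ℕ} {R Q : (ℕ → ℕ) → Prop} {v : ℕ → ℕ}
    (h : Wp D x₁ x₂ p T R v) (h' : ∀ v', R v' → Wp D x₁ x₂ q T' Q v') (hT : T + T' ≤ T'') :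
    Wp D x₁ x₂ (.seq p q) T'' Q v :=
  (Wp.seq (h.mono le_rfl h')).mono hT fun _ h => h

end rules

/-- With a level in register `40` and a place in register `41`, find the two places on the next
level (registers `45` and `46`) and the bit (register `49`). -/
def stepProg : Prog :=
  .seq (block [.op .div 42 41 2, .op .mod 43 41 2, .op .mul 44 40 3, .op .add 44 44 42,
      .op .add 44 44 6, .op .mul 44 44 7, .load 45 44, .op .add 44 44 5, .load 46 44,
      .op .add 44 44 5, .load 47 44, .const 48 0])
    (.seq (.loop (.lt 48 43)
        (block [.op .mod 49 47 6, .op .add 46 46 49, .op .sub 50 5 49, .op .add 45 45 50,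
          .op .div 47 47 6, .op .add 48 48 5]))
      (block [.op .mod 49 47 6]))

/-- With a level in register `30` and a place in register `31`, find the weight of the point
(register `32`). -/
def weightProg : Prog :=
  .seq (block [.move 40 30, .move 41 31])
    (.seq (.loop (.lt 40 2)
        (.seq stepProg
          (.seq (.ite (.eq 49 5) (block [.move 41 46]) (block [.move 41 45]))
            (block [.op .add 40 40 5]))))
      (block [.op .add 32 4 41, .load 32 32]))

/-- With a level in register `20` and a place in register `21`, find the total weight of the
preceding points (register `26`). -/
def psumProg : Prog :=
  .seq (block [.op .div 22 21 2, .op .mul 23 22 2, .op .mul 24 20 3, .op .add 24 24 22,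
      .op .add 24 24 6, .op .mul 24 24 7, .const 25 3, .op .add 24 24 25, .load 26 24])
    (.loop (.lt 23 21)
      (.seq (block [.move 30 20, .move 31 23])
        (.seq weightProg (block [.op .add 26 26 32, .op .add 23 23 5]))))

/-- With a place in register `10` and a key in register `11`, compute the sum of the walk
(register `13`). -/
def walkProg : Prog :=
  .seq (block [.const 12 0, .const 13 0, .move 14 8])
    (.loop (.lt 12 2)
      (.seq (block [.move 40 12, .move 41 10])
        (.seq stepProg
          (.seq (block [.op .add 12 12 5])
            (.seq (.ite (.lt 11 14) (block [.move 10 45])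
                (.seq (block [.move 20 12, .move 21 45, .move 16 46])
                  (.seq psumProg (block [.op .add 13 13 26, .move 10 16, .op .sub 11 11 14]))))
              (block [.op .div 14 14 6]))))))

/-- The words of `D` describe the points `L`, with keys of `H` bits, in `NB` blocks on every level;
the weights start at address `WB`. -/
structure Layout {w : ℕ} (D : Store w) (L : List (ℕ × ℕ)) (H NB WB : ℕ) : Prop where
  pos : 0 < H
  len : L.length < 2 ^ H
  blocks : L.length / H < NB
  weights : 4 * ((H + 1) * NB + 2) ≤ WB
  small : WB + L.length < 2 ^ w
  small_pow : 2 ^ H < 2 ^ w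
  word_zero : D.word 0 = L.length
  word_one : D.word 1 = H
  word_two : D.word 2 = NB
  word_three : D.word 3 = WB
  word_four : D.word 4 = 2 ^ (H - 1)
  word_lo : ∀ j < H, ∀ k < NB,
    D.word ((j * NB + k + 2) * 4) = lo (H - 1 - j) (level H L j) (k * H)
  word_hi : ∀ j < H, ∀ k < NB,
    D.word ((j * NB + k + 2) * 4 + 1) = hi (H - 1 - j) (level H L j) (k * H)
  word_bits : ∀ j < H, ∀ k < NB,
    D.word ((j * NB + k + 2) * 4 + 2) = bits (H - 1 - j) (level H L j) (k * H) H
  word_psum : ∀ j ≤ H, ∀ k < NB,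
    D.word ((j * NB + k + 2) * 4 + 3) = psum (level H L j) (k * H)
  word_weight : ∀ p e, (level H L H)[p]? = some e → D.word (WB + p) = e.2

/-- The registers that hold constants during the query. -/
structure Header (v : ℕ → ℕ) (L : List (ℕ × ℕ)) (H NB WB : ℕ) : Prop where
  h1 : v 1 = L.length
  h2 : v 2 = H
  h3 : v 3 = NB
  h4 : v 4 = WB
  h5 : v 5 = 1
  h6 : v 6 = 2
  h7 : v 7 = 4
  h8 : v 8 = 2 ^ (H - 1)

variable {w : ℕ} {D : Store w} {x₁ x₂ : ℝ} {L : List (ℕ × ℕ)} {H NB WB : ℕ}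

theorem Header.congr {v v' : ℕ → ℕ} (h : Header v L H NB WB)
    (hf : ∀ i, 1 ≤ i → i < 9 → v' i = v i) : Header v' L H NB WB where
  h1 := (hf _ (by omega) (by omega)).trans h.h1
  h2 := (hf _ (by omega) (by omega)).trans h.h2
  h3 := (hf _ (by omega) (by omega)).trans h.h3
  h4 := (hf _ (by omega) (by omega)).trans h.h4
  h5 := (hf _ (by omega) (by omega)).trans h.h5
  h6 := (hf _ (by omega) (by omega)).trans h.h6
  h7 := (hf _ (by omega) (by omega)).trans h.h7
  h8 := (hf _ (by omega) (by omega)).trans h.h8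

theorem Header.frame {v v' : ℕ → ℕ} {k : ℕ} (h : Header v L H NB WB) (hf : Frame k v v')
    (hk : 9 ≤ k := by norm_num) : Header v' L H NB WB :=
  h.congr fun _ _ hi => hf _ (by omega)

/-! ### Correctness and cost of the descent -/

namespace Layout

/-- The summand `2` skips eight header words, the room of two records. The bottom level `j = H` is
included because its prefix weights are stored as well. -/
theorem addr_le (h : Layout D L H NB WB) {j k : ℕ} (hj : j ≤ H) (hk : k < NB) :
    (j * NB + k + 2) * 4 + 4 ≤ WB := by
  have h1 : j * NB ≤ H * NB := Nat.mul_le_mul_right _ hj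
  have h2 := h.weights
  rw [add_mul, one_mul] at h2
  omega

theorem H_lt (h : Layout D L H NB WB) : H < 2 ^ w := Nat.lt_two_pow_self.trans h.small_pow

theorem two_lt (h : Layout D L H NB WB) : 2 < 2 ^ w := by
  have := h.weights
  have := h.small
  omega

theorem len_lt (h : Layout D L H NB WB) : L.length < 2 ^ w := h.len.trans h.small_pow

/-- A place may equal the length, the end of the last prefix. If `H` divides the length this place
begins a block of its own, which must exist. -/
theorem block_lt (h : Layout D L H NB WB) {p : ℕ} (hp : p ≤ L.length) : p / H < NB :=
  (Nat.div_le_div_right hp).trans_lt h.blocks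

/-- The record of the block gives both places at its start; scanning the first `p % H` digits of the
packed bits carries them on to `p`. The bit is claimed only if there is a point at `p`. -/
theorem wp_step (h : Layout D L H NB WB) {v : ℕ → ℕ} (hv : Header v L H NB WB) {j p : ℕ}
    (hj : j < H) (hp : p ≤ L.length) (h40 : v 40 = j) (h41 : v 41 = p) :
    Wp D x₁ x₂ stepProg (30 * H)
      (fun v' => Frame 42 v v' ∧ v' 45 = lo (H - 1 - j) (level H L j) p ∧
        v' 46 = hi (H - 1 - j) (level H L j) p ∧
        ∀ e, (level H L j)[p]? = some e → v' 49 = (bit (H - 1 - j) e).toNat) v := by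
  set b := H - 1 - j
  set K := level H L j
  have hK : K.length = L.length := length_level _ _ _
  have hk := h.block_lt hp
  have ha := h.addr_le hj.le hk
  have hs := h.small
  have hH := h.H_lt
  have h2w := h.two_lt
  have hr : p % H < H := Nat.mod_lt _ h.pos
  have hpd : p / H * H + p % H = p := by rw [mul_comm]; exact Nat.div_add_mod p H
  have hmod : ∀ x : Bool, x.toNat ≤ 1 := fun x => Nat.le_of_lt_succ (Bool.toNat_lt x)
  have hbits : ∀ q r, r ≤ H → bits b K q r < 2 ^ w := fun q r hr =>
    (bits_lt _ _ _ _).trans_le ((Nat.pow_le_pow_right two_pos hr).trans h.small_pow.le)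
  unfold stepProg
  refine Wp.comp (Wp.block (Q := fun v' => Frame 42 v v' ∧ v' 43 = p % H ∧
    v' 45 = lo b K (p / H * H) ∧ v' 46 = hi b K (p / H * H) ∧ v' 47 = bits b K (p / H * H) H ∧
    v' 48 = 0) ?_) (T' := p % H * 8 + 3) ?_ ?_
  · simp only [Block, BinOp.nat, BinOp.Safe, Function.update_apply, hv.h2, hv.h3, hv.h5, hv.h6,
      hv.h7, h40, h41, Nat.reduceEqDiff, if_true, if_false, true_and, Nat.reduceLeDiff,
      frame_update, Frame.refl]
    rw [h.word_lo j hj _ hk, h.word_hi j hj _ hk, add_assoc _ 1 1, h.word_bits j hj _ hk]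
    refine ⟨⟨?_, ?_⟩, ⟨?_, ?_⟩, ?_, ?_, ?_, rfl, rfl, rfl, trivial⟩ <;> omega
  · rintro v1 ⟨hf, h43, h45, h46, h47, h48⟩
    have hv1 := hv.frame hf
    refine Wp.comp (R := fun v' => Frame 42 v v' ∧
      v' 45 = lo b K p ∧ v' 46 = hi b K p ∧ v' 47 = bits b K p (H - p % H)) (Wp.loop_lt (p % H)
      (fun i v' => Frame 42 v v' ∧ v' 43 = p % H ∧
        v' 45 = lo b K (p / H * H + i) ∧ v' 46 = hi b K (p / H * H + i) ∧
        v' 47 = bits b K (p / H * H + i) (H - i) ∧ v' 48 = i) ⟨hf, h43, h45, h46, h47, h48⟩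
      ?_ ?_ ?_ (T := 7)) (T' := 2) ?_ (by omega)
    · rintro k v2 hk ⟨-, h1, -, -, -, h2⟩
      omega
    · rintro k v2 hk ⟨hf, h43, h45, h46, h47, h48⟩
      have hv2 := hv.frame hf
      refine ⟨by omega, Wp.block ?_⟩
      have hlt : p / H * H + k < K.length := by omega
      have hb1 := bits_succ (h := b) hlt (H - (k + 1))
      rw [show H - (k + 1) + 1 = H - k by omega] at hb1
      have hb2 := hmod (bit b K[p / H * H + k])
      have hb3 := hbits (p / H * H + k) (H - k) (by omega)
      have hm : bits b K (p / H * H + k) (H - k) % 2 = (bit b K[p / H * H + k]).toNat := by omega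
      simp only [Block, BinOp.nat, BinOp.Safe, Function.update_apply, hv2.h5, hv2.h6, h43, h45,
        h46, h47, h48, Nat.reduceEqDiff, if_true, if_false, true_and, Nat.reduceLeDiff,
        frame_update, hf, hm, ← add_assoc, lo_succ hlt, hi_succ hlt]
      exact ⟨⟨hb3, h2w⟩, hb2, ⟨hb3, h2w⟩, by omega, trivial⟩
    · rintro v2 ⟨hf, h43, h45, h46, h47, h48⟩
      rw [hpd] at h45 h46 h47
      exact ⟨by omega, hf, h45, h46, h47⟩
    · rintro v2 ⟨hf, h45, h46, h47⟩
      have hv2 := hv.frame hf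
      refine Wp.block ?_
      simp only [Block, BinOp.nat, BinOp.Safe, Function.update_apply, hv2.h6, h45,
        h46, h47, Nat.reduceEqDiff, if_true, if_false, true_and, Nat.reduceLeDiff,
        frame_update, hf]
      refine ⟨⟨hbits _ _ (by omega), h2w⟩, fun e he => ?_⟩
      obtain ⟨hlt, rfl⟩ := List.getElem?_eq_some_iff.1 he
      -- Since `p % H < H`, at least one digit is left, and the lowest is the bit at `p`.
      have hb1 := bits_succ (h := b) hlt (H - p % H - 1)
      rw [show H - p % H - 1 + 1 = H - p % H by omega] at hb1
      have hb2 := hmod (bit b K[p])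
      omega
  · simp only [List.length_cons, List.length_nil]
    omega

/-- At most `H` steps of cost `O(H)`. The invariant is that the current place on the current level
holds the same point `e`. -/
theorem wp_weight (h : Layout D L H NB WB) {v : ℕ → ℕ} (hv : Header v L H NB WB) {j p : ℕ}
    {e : ℕ × ℕ} (hj : j ≤ H) (he : (level H L j)[p]? = some e) (h30 : v 30 = j)
    (h31 : v 31 = p) :
    Wp D x₁ x₂ weightProg (50 * H ^ 2) (fun v' => Frame 32 v v' ∧ v' 32 = e.2) v := by
  have hs := h.small
  have hH := h.H_lt
  have h2w := h.two_lt
  have hp : p < L.length := by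
    simpa using (List.getElem?_eq_some_iff.1 he).1
  unfold weightProg
  refine Wp.comp (Wp.block (Q := fun v' => Frame 32 v v' ∧ v' 40 = j ∧ v' 41 = p) ?_)
    (T' := (H - j) * (30 * H + 8) + 4) ?_ ?_
  · simp only [Block, Function.update_apply, h30, h31, Nat.reduceEqDiff, if_true, if_false,
      Nat.reduceLeDiff, frame_update, Frame.refl, and_self]
  · rintro v1 ⟨hf, h40, h41⟩
    refine Wp.comp (R := fun v' => Frame 32 v v' ∧ (level H L H)[v' 41]? = some e)
      (Wp.loop_lt (H - j) (fun i v' => Frame 32 v v' ∧ v' 40 = j + i ∧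
        (level H L (j + i))[v' 41]? = some e) ⟨hf, h40, h41 ▸ he⟩ ?_ ?_ ?_
        (T := 30 * H + 7)) (T' := 3) ?_ (by rw [add_assoc])
    · rintro k v2 hk ⟨hf, h40, -⟩
      rw [(hv.frame hf).h2]
      omega
    · rintro k v2 hk ⟨hf, h40, h41⟩
      have hv2 := hv.frame hf
      have hlt : v2 41 < L.length := by
        simpa using (List.getElem?_eq_some_iff.1 h41).1
      refine ⟨by rw [hv2.h2]; omega, ?_⟩
      refine Wp.comp (h.wp_step hv2 (show j + k < H by omega) hlt.le h40 rfl) (T' := 6) ?_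
        (by omega)
      rintro v3 ⟨hf3, h45, h46, h49⟩
      have hv3 := hv2.frame hf3
      have h49 := h49 e h41
      have h41' := getElem?_part (h := H - 1 - (j + k)) h41
      refine Wp.comp (R := fun v' => Frame 32 v v' ∧ v' 40 = j + k ∧
        (level H L (j + (k + 1)))[v' 41]? = some e) (T' := 2) (Wp.ite_eq (T := 2) ?_ ?_ ?_ ?_)
        ?_ (by omega)
      · rw [h49]; have := Bool.toNat_lt (bit (H - 1 - (j + k)) e); omega
      · rw [hv3.h5]; omega
      · intro hb
        rw [h49, hv3.h5, Bool.toNat_eq_one] at hb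
        rw [if_pos hb] at h41'
        refine Wp.block ?_
        simp only [Block, Function.update_apply, hf3 40 (by norm_num), h40, h46,
          Nat.reduceEqDiff, if_true, if_false, Nat.reduceLeDiff, frame_update, true_and]
        exact ⟨hf.trans hf3, h41'⟩
      · intro hb
        rw [h49, hv3.h5, Bool.toNat_eq_one] at hb
        rw [if_neg hb] at h41'
        refine Wp.block ?_
        simp only [Block, Function.update_apply, hf3 40 (by norm_num), h40, h45,
          Nat.reduceEqDiff, if_true, if_false, Nat.reduceLeDiff, frame_update, true_and]
        exact ⟨hf.trans hf3, h41'⟩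
      · rintro v4 ⟨hf4, h40, h41⟩
        refine Wp.block ?_
        simp only [Block, BinOp.nat, BinOp.Safe, Function.update_apply, h40, (hv.frame hf4).h5,
          Nat.reduceEqDiff, if_true, if_false, Nat.reduceLeDiff, frame_update, true_and, add_assoc]
        exact ⟨hf4, h41⟩
    · rintro v2 ⟨hf, h40, h41⟩
      rw [Nat.add_sub_cancel' hj] at h40 h41
      exact ⟨by rw [(hv.frame hf).h2, h40], hf, h41⟩
    · rintro v2 ⟨hf, h41⟩
      have hlt : v2 41 < L.length := by
        simpa using (List.getElem?_eq_some_iff.1 h41).1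
      refine Wp.block ?_
      simp only [Block, BinOp.nat, BinOp.Safe, Function.update_apply, (hv.frame hf).h4,
        if_true, Nat.reduceLeDiff, frame_update, true_and]
      exact ⟨by omega, hf, h.word_weight _ _ h41⟩
  · have h1 : (H - j) * (30 * H + 8) ≤ H * (30 * H + 8) := Nat.mul_le_mul_right _ (by omega)
    have h2 := h.pos
    simp only [List.length_cons, List.length_nil]
    nlinarith

/-- The stored prefix weight at the block start is completed by fewer than `H` single weights. -/
theorem wp_psum (h : Layout D L H NB WB) {v : ℕ → ℕ} (hv : Header v L H NB WB) {j p : ℕ}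
    (hj : j ≤ H) (hp : p ≤ L.length) (h20 : v 20 = j) (h21 : v 21 = p) :
    Wp D x₁ x₂ psumProg (70 * H ^ 3)
      (fun v' => Frame 22 v v' ∧ v' 26 = psum (level H L j) p) v := by
  set K := level H L j with hKdef
  have hK : K.length = L.length := length_level _ _ _
  have hk := h.block_lt hp
  have ha := h.addr_le hj hk
  have hs := h.small
  have hH := h.H_lt
  have h2w := h.two_lt
  have hr : p % H < H := Nat.mod_lt _ h.pos
  have hpd : p / H * H + p % H = p := by rw [mul_comm]; exact Nat.div_add_mod p H
  unfold psumProg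
  refine Wp.comp (Wp.block (Q := fun v' => Frame 22 v v' ∧ v' 23 = p / H * H ∧
    v' 26 = psum K (p / H * H)) ?_) (T' := p % H * (50 * H ^ 2 + 7) + 1) ?_ ?_
  · simp only [Block, BinOp.nat, BinOp.Safe, Function.update_apply, hv.h2, hv.h3, hv.h6,
      hv.h7, h20, h21, Nat.reduceEqDiff, if_true, if_false, true_and, Nat.reduceLeDiff,
      frame_update, Frame.refl]
    rw [h.word_psum j hj _ hk]
    exact ⟨by omega, by omega, rfl⟩
  · rintro v1 ⟨hf, h23, h26⟩
    refine Wp.loop_lt (p % H) (fun i v' => Frame 22 v v' ∧ v' 23 = p / H * H + i ∧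
      v' 26 = psum K (p / H * H + i)) ⟨hf, h23, h26⟩ ?_ ?_ ?_ (T := 50 * H ^ 2 + 6)
    · rintro k v2 hk ⟨hf, h23, -⟩
      rw [hf 21 (by norm_num)]
      omega
    · rintro k v2 hk ⟨hf, h23, h26⟩
      have hlt : p / H * H + k < K.length := by omega
      refine ⟨by rw [hf 21 (by norm_num)]; omega, ?_⟩
      refine Wp.comp (Wp.block (Q := fun v' => Frame 22 v v' ∧ v' 23 = p / H * H + k ∧
        v' 26 = psum K (p / H * H + k) ∧ v' 30 = j ∧ v' 31 = p / H * H + k) ?_)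
        (T' := 50 * H ^ 2 + 3) ?_ (by simp only [List.length_cons, List.length_nil]; omega)
      · simp only [Block, Function.update_apply, hf 20 (by norm_num), h20, h23, h26,
          Nat.reduceEqDiff, if_true, if_false, true_and, Nat.reduceLeDiff, frame_update, hf]
      · rintro v3 ⟨hf3, h23, h26, h30, h31⟩
        refine Wp.comp (h.wp_weight (hv.frame hf3) hj (List.getElem?_eq_getElem hlt) h30 h31)
          (T' := 3) ?_ (by omega)
        rintro v4 ⟨hf4, h32⟩
        have hf5 := hf3.trans hf4
        refine Wp.block ?_
        simp only [Block, BinOp.nat, BinOp.Safe, Function.update_apply, (hv.frame hf5).h5, h32,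
          hf4 23 (by norm_num), hf4 26 (by norm_num), h23, h26, Nat.reduceEqDiff, if_true,
          if_false, true_and, Nat.reduceLeDiff, frame_update, ← add_assoc, psum_succ hlt, hf5]
    · rintro v2 ⟨hf, h23, h26⟩
      rw [hpd] at h23 h26
      exact ⟨by rw [hf 21 (by norm_num)]; omega, hf, h26⟩
  · have h1 : p % H * (50 * H ^ 2 + 7) ≤ H * (50 * H ^ 2 + 7) := Nat.mul_le_mul_right _ hr.le
    have h2 := h.pos
    have h3 : H ≤ H ^ 3 := Nat.le_self_pow (by norm_num) H
    simp only [List.length_cons, List.length_nil]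
    have h4 : H * (50 * H ^ 2 + 7) = 50 * H ^ 3 + 7 * H := by ring
    omega

theorem wp_walk (h : Layout D L H NB WB) {v : ℕ → ℕ} (hv : Header v L H NB WB) {p b : ℕ}
    (hp : p ≤ L.length) (hb : b < 2 ^ H) (h10 : v 10 = p) (h11 : v 11 = b) :
    Wp D x₁ x₂ walkProg (200 * H ^ 4) (fun v' => Frame 10 v v' ∧ v' 13 = walk H b L p) v := by
  have hs := h.small
  have hsp := h.small_pow
  have hH := h.H_lt
  have h2w := h.two_lt
  have hpow : ∀ k, k ≤ H → 2 ^ k < 2 ^ w := fun k hk =>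
    (Nat.pow_le_pow_right two_pos hk).trans_lt hsp
  unfold walkProg
  refine Wp.comp (Wp.block (Q := fun v' => Frame 10 v v' ∧ v' 10 = p ∧ v' 11 = b ∧ v' 12 = 0 ∧
    v' 13 = 0 ∧ v' 14 = 2 ^ (H - 1)) ?_) (T' := H * (30 * H + 70 * H ^ 3 + 20) + 1) ?_ ?_
  · simp only [Block, Function.update_apply, h10, h11, hv.h8, Nat.reduceEqDiff, if_true, if_false,
      Nat.reduceLeDiff, frame_update, Frame.refl, and_self]
  · rintro v1 ⟨hf, h10, h11, h12, h13, h14⟩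
    -- The accumulated sum plus the walk still to be made is constant.
    refine Wp.loop_lt H (fun j v' => Frame 10 v v' ∧ v' 10 ≤ L.length ∧ v' 11 < 2 ^ (H - j) ∧
      v' 12 = j ∧ v' 14 = 2 ^ (H - j) / 2 ∧
      walk H b L p = v' 13 + walk (H - j) (v' 11) (level H L j) (v' 10))
      ⟨hf, h10 ▸ hp, by simpa [h11] using hb, h12, ?_, ?_⟩ ?_ ?_ ?_
      (T := 30 * H + 70 * H ^ 3 + 19)
    · rw [h14, Nat.sub_zero, ← Nat.pow_pred_mul h.pos, Nat.mul_div_cancel _ two_pos]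
    · simp [h10, h11, h13, level]
    · rintro k v2 hk ⟨hf, -, -, h12, -⟩
      rw [(hv.frame hf).h2]
      omega
    · rintro j v2 hj ⟨hf, h10, h11, h12, h14, hwalk⟩
      have hv2 := hv.frame hf
      have hsub : H - j = (H - 1 - j) + 1 := by omega
      have hsub' : H - (j + 1) = H - 1 - j := by omega
      rw [hsub, pow_succ, Nat.mul_div_cancel _ two_pos] at h14
      rw [hsub] at h11 hwalk
      refine ⟨by rw [hv2.h2]; omega, ?_⟩
      refine Wp.comp (Wp.block (Q := fun v' => Frame 15 v2 v' ∧ v' 40 = j ∧ v' 41 = v2 10) ?_)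
        (T' := 30 * H + 70 * H ^ 3 + 16) ?_
        (by simp only [List.length_cons, List.length_nil]; omega)
      · simp only [Block, Function.update_apply, h12, Nat.reduceEqDiff, if_true, if_false,
          Nat.reduceLeDiff, frame_update, Frame.refl, and_self]
      rintro v3 ⟨hf3, h40, h41⟩
      refine Wp.comp (h.wp_step (hv2.frame hf3) hj h10 h40 h41) (T' := 70 * H ^ 3 + 16) ?_
        (by omega)
      rintro v4 ⟨hf4, h45, h46, -⟩
      have hf4 := hf3.trans hf4
      refine Wp.comp (Wp.block (Q := fun v' => Frame 10 v v' ∧ v' 10 = v2 10 ∧ v' 11 = v2 11 ∧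
        v' 12 = j + 1 ∧ v' 13 = v2 13 ∧ v' 14 = v2 14 ∧
        v' 45 = lo (H - 1 - j) (level H L j) (v2 10) ∧
        v' 46 = hi (H - 1 - j) (level H L j) (v2 10)) ?_)
        (T' := 70 * H ^ 3 + 14) ?_
        (by simp only [List.length_cons, List.length_nil]; omega)
      · simp only [Block, BinOp.nat, BinOp.Safe, Function.update_apply, (hv2.frame hf4).h5, h45,
          h46, hf4 10 (by norm_num), hf4 11 (by norm_num), hf4 12 (by norm_num),
          hf4 13 (by norm_num), hf4 14 (by norm_num), h12, Nat.reduceEqDiff, if_true, if_false,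
          Nat.reduceLeDiff, frame_update, and_true, true_and]
        exact hf.trans (k' := 15) hf4
      rintro v5 ⟨hf5, h10', h11', h12', h13', h14', h45, h46⟩
      have hv5 := hv.frame hf5
      have hlo := lo_le (H - 1 - j) (level H L j) (v2 10)
      have hhi := hi_le (H - 1 - j) (level H L j) (v2 10)
      rw [length_level] at hlo hhi
      rw [walk] at hwalk
      refine Wp.comp (R := fun v' => Frame 10 v v' ∧ v' 10 ≤ L.length ∧ v' 11 < 2 ^ (H - 1 - j) ∧
        v' 12 = j + 1 ∧ v' 14 = 2 ^ (H - 1 - j) ∧ walk H b L p =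
          v' 13 + walk (H - 1 - j) (v' 11) (level H L (j + 1)) (v' 10)) (T' := 2)
        (Wp.ite_lt (T := 70 * H ^ 3 + 10) ?_ ?_ ?_ ?_) ?_ (by omega)
      · rw [h11']
        exact h11.trans (hpow _ (by omega))
      · rw [h14', h14]
        exact hpow _ (by omega)
      · intro hlt
        rw [h11', h14', h14] at hlt
        rw [if_pos hlt] at hwalk
        refine (Wp.block ?_).mono (by simp only [List.length_cons, List.length_nil]; omega)
          fun _ h => h
        simp only [Block, Function.update_apply, h11', h12', h13', h14', h45, h14,
          Nat.reduceEqDiff, if_true, if_false, true_and, Nat.reduceLeDiff, frame_update]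
        exact ⟨hf5, hlo, hlt, hwalk⟩
      · intro hlt
        rw [h11', h14', h14] at hlt
        rw [if_neg hlt] at hwalk
        refine Wp.comp (Wp.block (Q := fun v' => Frame 15 v5 v' ∧ v' 16 = v5 46 ∧
          v' 20 = j + 1 ∧ v' 21 = v5 45) ?_) (T' := 70 * H ^ 3 + 4) ?_
          (by simp only [List.length_cons, List.length_nil]; omega)
        · simp only [Block, Function.update_apply, h12', Nat.reduceEqDiff, if_true, if_false,
            Nat.reduceLeDiff, frame_update, Frame.refl, and_self]
        rintro v6 ⟨hf6, h16, h20, h21⟩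
        refine Wp.comp (h.wp_psum (hv5.frame hf6) (show j + 1 ≤ H by omega)
          (h45 ▸ hlo) h20 h21) (T' := 4) ?_ (by omega)
        rintro v7 ⟨hf7, h26⟩
        have h16 := (hf7 16 (by norm_num)).trans h16
        have hf7 := hf6.trans hf7
        refine Wp.block ?_
        simp only [Block, BinOp.nat, BinOp.Safe, Function.update_apply, hf7 11 (by norm_num),
          hf7 12 (by norm_num), hf7 13 (by norm_num), hf7 14 (by norm_num), h16, h26, h11', h12',
          h13', h14', h14, h45, h46, Nat.reduceEqDiff, if_true, if_false, true_and,
          Nat.reduceLeDiff, frame_update]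
        refine ⟨not_lt.1 hlt, hf5.trans (k' := 15) hf7, hhi, ?_, ?_⟩
        · rw [pow_succ] at h11; omega
        · rw [hwalk, add_assoc]; rfl
      · rintro v6 ⟨hf6, h10, h11, h12, h14, hwalk⟩
        refine Wp.block ?_
        simp only [Block, BinOp.nat, BinOp.Safe, Function.update_apply, (hv.frame hf6).h6, h12,
          h14, hsub', Nat.reduceEqDiff, if_true, if_false, true_and, Nat.reduceLeDiff,
          frame_update]
        exact ⟨⟨hpow _ (by omega), h2w⟩, hf6, h10, h11, hwalk⟩
    · rintro v2 ⟨hf, -, -, h12, -, hwalk⟩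
      rw [Nat.sub_self, walk, add_zero] at hwalk
      exact ⟨by rw [(hv.frame hf).h2, h12], hf, hwalk.symm⟩
  · have h2 := h.pos
    have h3 : H ≤ H ^ 4 := Nat.le_self_pow (by norm_num) H
    have h4 : H ^ 2 ≤ H ^ 4 := Nat.pow_le_pow_right h2 (by norm_num)
    have h5 : H * (30 * H + 70 * H ^ 3 + 20) = 30 * H ^ 2 + 70 * H ^ 4 + 20 * H := by ring
    simp only [List.length_cons, List.length_nil]
    omega

end Layout

end RAM

/-! ### Binary search and the whole query -/

namespace RAM

open Wavelet

/-- Binary search among the real numbers that start at the address in register `10`; the test `b`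
with its branches `p` and `q` decides about the number in real register `2`. The result is left in
register `11`. -/
def searchProg (b : Test) (p q : Prog) : Prog :=
  .seq (block [.const 11 0, .move 12 8, .const 13 0])
    (.loop (.lt 13 2)
      (.seq (block [.op .add 14 11 12])
        (.seq (.ite (.lt 1 14) (block [])
            (.seq (block [.op .add 15 10 14, .op .sub 15 15 5])
              (.seq (.instr (.loadR 2 15)) (.ite b p q))))
          (block [.op .div 12 12 6, .op .add 13 13 5]))))

/-- The query program. -/
def queryProg : Prog :=
  .seq (block [.const 5 1, .load 1 9])
    (.ite (.eq 1 9) (block [])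
      (.seq (block [.const 6 2, .const 7 4, .load 2 5, .load 3 6, .const 9 3, .load 4 9, .load 8 7,
          .const 10 0])
        (.seq (searchProg (.leR 0 2) (block []) (block [.move 11 14]))
          (.seq (block [.move 9 11, .move 10 1])
            (.seq (searchProg (.leR 2 1) (block [.move 11 14]) (block []))
              (.seq (block [.move 0 11, .move 10 1])
                (.seq walkProg
                  (.seq (block [.move 10 9, .move 9 13, .move 11 0])
                    (.seq walkProg (block [.op .sub 0 9 13]))))))))))

variable {w : ℕ} {D : Store w} {x₁ x₂ : ℝ} {L : List (ℕ × ℕ)} {H NB WB : ℕ}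

namespace Layout

/-- The real memory holds two lists of this length; with `small`, the bound makes all its addresses
representable. -/
theorem len_le_weights (h : Layout D L H NB WB) : L.length ≤ WB := by
  have h1 := (Nat.div_lt_iff_lt_mul h.pos).1 h.blocks
  have h2 := h.weights
  have h3 : (H + 1) * NB = NB * H + NB := by ring
  omega

/-- The binary digits of `c` are found from the top: a candidate `t` satisfies `t ≤ c` exactly when
`t ≤ L.length` and `P` holds for entry `t - 1`. The hypothesis `hb` leaves open which branch of the
test means `P`, since only `≤` is available for reals and the first search needs `<`. -/
theorem wp_search (h : Layout D L H NB WB) {v : ℕ → ℕ} (hv : Header v L H NB WB) {b : Test}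
    {p q : Prog} {P : ℝ → Prop} {off c : ℕ} (hoff : off ≤ L.length) (hc : c ≤ L.length)
    (hP : ∀ i < L.length, P (D.reals.getD (off + i) 0) ↔ i < c)
    (hb : ∀ (v : ℕ → ℕ) (Q : (ℕ → ℕ) → Prop), v 15 < 2 ^ w →
      (P (D.reals.getD (v 15) 0) → Q (Function.update v 11 (v 14))) →
      (¬ P (D.reals.getD (v 15) 0) → Q v) →
      Wp D x₁ x₂ (.seq (.instr (.loadR 2 15)) (.ite b p q)) 4 Q v)
    (h10 : v 10 = off) :
    Wp D x₁ x₂ (searchProg b p q) (30 * H) (fun v' => Frame 10 v v' ∧ v' 11 = c) v := by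
  have hs := h.small
  have hsp := h.small_pow
  have hlen := h.len_le_weights
  have h2w := h.two_lt
  have hH := h.H_lt
  unfold searchProg
  refine Wp.comp (Wp.block (Q := fun v' => Frame 11 v v' ∧ v' 11 = 0 ∧ v' 12 = 2 ^ (H - 1) ∧
    v' 13 = 0) ?_) (T' := H * 14 + 1) ?_ ?_
  · simp only [Block, Function.update_apply, hv.h8, Nat.reduceEqDiff, if_true, if_false,
      Nat.reduceLeDiff, frame_update, Frame.refl, and_self]
  · rintro v1 ⟨hf, h11, h12, h13⟩
    -- The bound by `2 ^ H` keeps the next candidate below `2 ^ w`, even when it exceeds the length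
    -- of the list.
    refine Wp.loop_lt H (fun i v' => Frame 11 v v' ∧ v' 11 ≤ c ∧ c < v' 11 + 2 ^ (H - i) ∧
      v' 11 + 2 ^ (H - i) ≤ 2 ^ H ∧ v' 12 = 2 ^ (H - i) / 2 ∧ v' 13 = i)
      ⟨hf, by omega, ?_, by simp [h11], ?_, h13⟩ ?_ ?_ ?_ (T := 13)
    · have := h.len
      rw [Nat.sub_zero]; omega
    · rw [h12, Nat.sub_zero, ← Nat.pow_pred_mul h.pos, Nat.mul_div_cancel _ two_pos]
    · rintro k v2 hk ⟨hf, -, -, -, -, h13⟩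
      rw [(hv.frame hf).h2]
      omega
    · rintro i v2 hi ⟨hf, hle, hlt, hmax, h12, h13⟩
      have hv2 := hv.frame hf
      have hsub' : H - (i + 1) = H - 1 - i := by omega
      rw [show H - i = (H - 1 - i) + 1 by omega, pow_succ] at h12 hlt hmax
      rw [Nat.mul_div_cancel _ two_pos] at h12
      have hpos : 0 < 2 ^ (H - 1 - i) := Nat.two_pow_pos _
      have h1w : v2 1 < 2 ^ w := by rw [hv2.h1]; exact h.len_lt
      refine ⟨by rw [hv2.h2]; omega, ?_⟩
      refine Wp.comp (Wp.block (Q := fun v' => Frame 14 v2 v' ∧ v' 14 = v2 11 + v2 12) ?_)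
        (T' := 11) ?_ (by simp only [List.length_cons, List.length_nil]; omega)
      · simp only [Block, BinOp.nat, BinOp.Safe, Function.update_apply, if_true,
          Nat.reduceLeDiff, frame_update, Frame.refl, and_self]
      rintro v3 ⟨hf3, h14⟩
      have hv3 := hv2.frame hf3
      refine Wp.comp (R := fun v' => Frame 11 v2 v' ∧ v' 11 ≤ c ∧ c < v' 11 + 2 ^ (H - 1 - i) ∧
        v' 11 + 2 ^ (H - 1 - i) ≤ 2 ^ H ∧ v' 12 = v2 12 ∧ v' 13 = v2 13)
        (Wp.ite_lt (T := 7) ?_ ?_ ?_ ?_) (T' := 3) ?_ (by omega)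
      · rw [hv3.h1]; exact h.len_lt
      · omega
      · intro hgt
        rw [hv3.h1] at hgt
        refine (Wp.block ?_).mono (by simp) fun _ h => h
        simp only [Block, hf3 11 (by norm_num), hf3 12 (by norm_num), hf3 13 (by norm_num)]
        exact ⟨fun i hi => hf3 i (by omega), hle, by omega, by omega, trivial, trivial⟩
      · intro hgt
        rw [hv3.h1, not_lt] at hgt
        refine Wp.comp (Wp.block (Q := fun v' => Frame 15 v3 v' ∧ v' 15 = off + (v3 14 - 1)) ?_)
          (T' := 4) ?_ (by simp)
        · simp only [Block, BinOp.nat, BinOp.Safe, Function.update_apply, if_true, true_and,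
            Nat.reduceLeDiff, frame_update, Frame.refl, hf3 10 (by norm_num),
            hf 10 (by norm_num), h10, hv3.h5, Nat.reduceEqDiff, if_false]
          omega
        rintro v4 ⟨hf4, h15⟩
        have hi := hP (v3 14 - 1) (by omega)
        have hf5 : Frame 14 v2 v4 := hf3.trans (k' := 15) hf4
        refine hb _ _ (by omega) ?_ ?_
        · rw [h15, hi]
          intro hlt'
          simp only [Function.update_apply, Nat.reduceEqDiff, if_true, if_false, Nat.reduceLeDiff,
            frame_update, hf4 14 (by norm_num), hf5 12 (by norm_num), hf5 13 (by norm_num)]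
          exact ⟨fun i hi => hf5 i (by omega), by omega, by omega, by omega, trivial, trivial⟩
        · rw [h15, hi]
          intro hlt'
          rw [hf5 11 (by norm_num), hf5 12 (by norm_num), hf5 13 (by norm_num)]
          exact ⟨fun i hi => hf5 i (by omega), by omega, by omega, by omega, rfl, rfl⟩
      · rintro v4 ⟨hf4, h11, h11', hmax, h12', h13'⟩
        have hf5 := hf.trans (k' := 11) hf4
        refine Wp.block ?_
        simp only [Block, BinOp.nat, BinOp.Safe, Function.update_apply, if_true, true_and,
          Nat.reduceLeDiff, frame_update, hf5, (hv.frame hf5).h6, (hv.frame hf5).h5, h12', h13',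
          h12, h13, Nat.reduceEqDiff, if_false, hsub']
        exact ⟨⟨by omega, h2w⟩, h11, h11', hmax, trivial⟩
    · rintro v2 ⟨hf, hle, hlt, -, -, h13⟩
      rw [Nat.sub_self, pow_zero] at hlt
      exact ⟨by rw [(hv.frame hf).h2, h13], fun i hi => hf i (by omega), by omega⟩
  · have h1 := h.pos
    simp only [List.length_cons, List.length_nil]
    omega

theorem wp_query (h : Layout D L H NB WB) (hL : 0 < L.length) {c₁ c₂ : ℕ}
    (hc₁ : c₁ ≤ L.length) (hc₂ : c₂ ≤ L.length)
    (h₁ : ∀ i < L.length, D.reals.getD i 0 < x₁ ↔ i < c₁)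
    (h₂ : ∀ i < L.length, D.reals.getD (L.length + i) 0 ≤ x₂ ↔ i < c₂) :
    Wp D x₁ x₂ queryProg (600 * H ^ 4)
      (fun v => v 0 = below H c₂ L L.length - below H c₂ L c₁) 0 := by
  have hs := h.small
  have h2w := h.two_lt
  have hpow : 0 < 2 ^ w := Nat.two_pow_pos w
  have hw : WB ≥ 8 := by have := h.weights; omega
  unfold queryProg
  refine Wp.comp (Wp.block (Q := fun v' => v' 1 = L.length ∧ v' 5 = 1 ∧ v' 9 = 0) ?_)
    (T' := 60 * H + 400 * H ^ 4 + 30) ?_ ?_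
  · simp only [Block, Function.update_apply, Pi.zero_apply, Nat.reduceEqDiff, if_true, if_false,
      h.word_zero, and_self, hpow]
  · rintro v1 ⟨h1, h5, h9⟩
    refine Wp.ite_eq (T := 60 * H + 400 * H ^ 4 + 29) (by omega) (by omega) (fun h0 => ?_)
      (fun _ => ?_)
    · omega
    refine Wp.comp (Wp.block (Q := fun v' => Header v' L H NB WB ∧ v' 10 = 0) ?_)
      (T' := 60 * H + 400 * H ^ 4 + 20) ?_ (by simp only [List.length_cons, List.length_nil]; omega)
    · simp only [Block, Function.update_apply, Nat.reduceEqDiff, if_true, if_false, h5,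
        h.word_one, h.word_two, h.word_three, h.word_four, and_true]
      refine ⟨by omega, by omega, by omega, by omega, ?_⟩
      constructor <;> simp [h1, h5]
    rintro v2 ⟨hv2, h10⟩
    refine Wp.comp (h.wp_search hv2 (P := fun x => x < x₁) (Nat.zero_le _) hc₁
      (by simpa using h₁) ?_ h10) (T' := 30 * H + 400 * H ^ 4 + 20) ?_ (by omega)
    · intro v Q hv ht hf
      refine (Wp.loadR_ite (B := x₁ ≤ D.reals.getD (v 15) 0) (T := 2) hv ?_ ?_ ?_).mono le_rfl
        fun _ h => h
      · intro s h0 _ h2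
        rw [Test.holds, h0, h2]
      · intro hle
        exact (Wp.skip (hf (not_lt.2 hle))).mono (by simp) fun _ h => h
      · intro hle
        exact Wp.block (ht (not_le.1 hle))
    rintro v3 ⟨hf3, h11⟩
    refine Wp.comp (Wp.block (Q := fun v' => Frame 9 v2 v' ∧ v' 9 = c₁ ∧ v' 10 = L.length) ?_)
      (T' := 30 * H + 400 * H ^ 4 + 17) ?_ (by simp only [List.length_cons, List.length_nil]; omega)
    · simp only [Block, Function.update_apply, Nat.reduceEqDiff, if_true, if_false, h11,
        (hv2.frame hf3).h1, Nat.reduceLeDiff, frame_update, and_true, le_refl]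
      exact fun i hi => hf3 i (by omega)
    rintro v4 ⟨hf4, h9, h10⟩
    have hv4 := hv2.frame hf4
    refine Wp.comp (h.wp_search hv4 (P := fun x => x ≤ x₂) le_rfl hc₂ h₂ ?_ h10)
      (T' := 400 * H ^ 4 + 17) ?_ (by omega)
    · intro v Q hv ht hf
      refine Wp.loadR_ite (B := D.reals.getD (v 15) 0 ≤ x₂) (T := 2) hv ?_ ?_ ?_
      · intro s _ h1 h2
        rw [Test.holds, h1, h2]
      · intro hle
        exact Wp.block (ht hle)
      · intro hle
        exact (Wp.skip (hf hle)).mono (by simp) fun _ h => h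
    rintro v5 ⟨hf5, h11⟩
    have hv5 := hv4.frame hf5
    -- Registers `0` and `9` survive the first walk and keep the two counts for the second.
    refine Wp.comp (Wp.block (Q := fun v' => Header v' L H NB WB ∧ v' 0 = c₂ ∧ v' 9 = c₁ ∧
      v' 10 = L.length ∧ v' 11 = c₂) ?_) (T' := 400 * H ^ 4 + 13) ?_
      (by simp only [List.length_cons, List.length_nil]; omega)
    · simp only [Block, Function.update_apply, Nat.reduceEqDiff, if_true, if_false, h11,
        hf5 9 (by norm_num), h9, hv5.h1, and_true, OfNat.zero_ne_ofNat, OfNat.ofNat_ne_zero]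
      refine hv5.congr fun i h1 h2 => ?_
      rw [Function.update_of_ne (by omega), Function.update_of_ne (by omega)]
    rintro v6 ⟨hv6, h0, h9, h10, h11⟩
    have hc₂' : c₂ < 2 ^ H := hc₂.trans_lt h.len
    refine Wp.comp (h.wp_walk hv6 le_rfl hc₂' h10 h11) (T' := 200 * H ^ 4 + 13) ?_ (by omega)
    rintro v7 ⟨hf7, h13⟩
    refine Wp.comp (Wp.block (Q := fun v' => Frame 9 v6 v' ∧ v' 9 = walk H c₂ L L.length ∧
      v' 10 = c₁ ∧ v' 11 = c₂) ?_) (T' := 200 * H ^ 4 + 2) ?_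
      (by simp only [List.length_cons, List.length_nil]; omega)
    · simp only [Block, Function.update_apply, Nat.reduceEqDiff, if_true, if_false, h13,
        hf7 9 (by norm_num), hf7 0 (by norm_num), h9, h0, Nat.reduceLeDiff, frame_update, and_true,
        le_refl, OfNat.zero_ne_ofNat]
      exact fun i hi => hf7 i (by omega)
    rintro v8 ⟨hf8, h9, h10, h11⟩
    refine Wp.comp (h.wp_walk (hv6.frame hf8) hc₁ hc₂' h10 h11) (T' := 2) ?_ (by omega)
    rintro v9 ⟨hf9, h13⟩
    refine Wp.block ?_
    -- The walks for the full list and for its first `c₁` points differ by the required weight;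
    -- monotonicity of `below` makes the machine subtraction exact.
    have hd := walk_add_below H hc₂' L L.length c₁
    have hm := below_mono H c₂ L hc₁
    simp only [Block, BinOp.nat, BinOp.Safe, Function.update_apply, if_true, h13,
      hf9 9 (by norm_num), h9]
    omega
  · have h1 := h.pos
    have h2 : H ≤ H ^ 4 := Nat.le_self_pow (by norm_num) H
    simp only [List.length_cons, List.length_nil]
    omega

end Layout

end RAM

/-! ## The data structure -/

namespace RAM

open Wavelet

/-- The words that describe the points `L` with keys of `H` bits in `NB` blocks on every level, the
weights starting at address `WB`. -/
def content (L : List (ℕ × ℕ)) (H NB WB a : ℕ) : ℕ :=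
  if a < 8 then
    if a = 0 then L.length else if a = 1 then H else if a = 2 then NB else if a = 3 then WB
    else if a = 4 then 2 ^ (H - 1) else 0
  else if a < WB then
    let j := (a / 4 - 2) / NB
    let k := (a / 4 - 2) % NB
    if a % 4 = 0 then lo (H - 1 - j) (level H L j) (k * H)
    else if a % 4 = 1 then hi (H - 1 - j) (level H L j) (k * H)
    else if a % 4 = 2 then bits (H - 1 - j) (level H L j) (k * H) H
    else psum (level H L j) (k * H)
  else ((level H L H).getD (a - WB) 0).2

/-- The structure for the points `L`, with keys of `H` bits, and the real numbers `R`. -/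
def store (w H : ℕ) (L : List (ℕ × ℕ)) (R : List ℝ) : Store w where
  words := (List.range (4 * ((H + 1) * (L.length / H + 1) + 2) + L.length)).map fun a =>
    BitVec.ofNat w (content L H (L.length / H + 1) (4 * ((H + 1) * (L.length / H + 1) + 2)) a)
  reals := R

theorem layout_store {w H : ℕ} {L : List (ℕ × ℕ)} {R : List ℝ} (hH : 0 < H)
    (hlen : L.length < 2 ^ H)
    (hsmall : 4 * ((H + 1) * (L.length / H + 1) + 2) + L.length < 2 ^ w)
    (hpow : 2 ^ H < 2 ^ w) (hsum : (L.map Prod.snd).sum < 2 ^ w) :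
    Layout (store w H L R) L H (L.length / H + 1) (4 * ((H + 1) * (L.length / H + 1) + 2)) := by
  set NB := L.length / H + 1 with hNB
  set WB := 4 * ((H + 1) * NB + 2) with hWB
  have hsum' : ∀ j, ((level H L j).map Prod.snd).sum < 2 ^ w := fun j => by
    rwa [((level_perm H L j).map Prod.snd).sum_eq]
  have hlt : ∀ a, content L H NB WB a < 2 ^ w := by
    intro a
    have h1 : 2 ^ (H - 1) ≤ 2 ^ H := Nat.pow_le_pow_right two_pos (by omega)
    have h2 : NB ≤ (H + 1) * NB := Nat.le_mul_of_pos_left _ (by omega)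
    have h3 : ∀ h j p, lo h (level H L j) p ≤ L.length := fun h j p =>
      (lo_le _ _ _).trans_eq (length_level _ _ _)
    have h4 : ∀ h j p, hi h (level H L j) p ≤ L.length := fun h j p =>
      (hi_le _ _ _).trans_eq (length_level _ _ _)
    have h5 : H < 2 ^ H := Nat.lt_two_pow_self
    simp only [content]
    split_ifs <;> try omega
    · exact (h3 _ _ _).trans_lt (hlen.trans hpow)
    · exact (h4 _ _ _).trans_lt (hlen.trans hpow)
    · exact (bits_lt _ _ _ _).trans hpow
    · exact (psum_le _ _).trans_lt (hsum' _)
    · refine lt_of_le_of_lt ?_ (hsum' H)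
      rw [List.getD_eq_getElem?_getD]
      cases he : (level H L H)[a - WB]? with
      | none => exact Nat.zero_le _
      | some e => exact List.le_sum_of_mem (List.mem_map_of_mem (List.mem_of_getElem? he))
  have hword : ∀ a < WB + L.length, (store w H L R).word a = content L H NB WB a := by
    intro a ha
    have : a < ((List.range (WB + L.length)).map fun a =>
      BitVec.ofNat w (content L H NB WB a)).length := by simpa using ha
    change (((List.range (WB + L.length)).map fun a =>
      BitVec.ofNat w (content L H NB WB a)).getD a 0).toNat = _
    rw [List.getD_eq_getElem _ _ this, List.getElem_map, List.getElem_range, BitVec.toNat_ofNat,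
      Nat.mod_eq_of_lt (hlt a)]
  have hWB8 : 8 ≤ WB := by omega
  have haddr : ∀ j ≤ H, ∀ k < NB, (j * NB + k + 2) * 4 + 4 ≤ WB := by
    intro j hj k hk
    have h1 : j * NB ≤ H * NB := Nat.mul_le_mul_right _ hj
    have h2 : (H + 1) * NB = H * NB + NB := by ring
    omega
  -- An address decodes uniquely to level, block and field.
  have hdiv : ∀ j k i, k < NB → i < 4 → (((j * NB + k + 2) * 4 + i) / 4 - 2) / NB = j ∧
      (((j * NB + k + 2) * 4 + i) / 4 - 2) % NB = k := by
    intro j k i hk hi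
    have h1 : ((j * NB + k + 2) * 4 + i) / 4 - 2 = j * NB + k := by omega
    rw [h1]
    constructor
    · rw [mul_comm, Nat.mul_add_div (by omega), Nat.div_eq_of_lt hk, add_zero]
    · rw [mul_comm, Nat.mul_add_mod, Nat.mod_eq_of_lt hk]
  have hrec : ∀ j ≤ H, ∀ k < NB, ∀ i < 4, (store w H L R).word ((j * NB + k + 2) * 4 + i) =
      if i = 0 then lo (H - 1 - j) (level H L j) (k * H)
      else if i = 1 then hi (H - 1 - j) (level H L j) (k * H)
      else if i = 2 then bits (H - 1 - j) (level H L j) (k * H) H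
      else psum (level H L j) (k * H) := by
    intro j hj k hk i hi
    have h1 := haddr j hj k hk
    rw [hword _ (by omega)]
    simp only [content]
    rw [if_neg (by omega), if_pos (by omega), (hdiv j k i hk hi).1, (hdiv j k i hk hi).2,
      show ((j * NB + k + 2) * 4 + i) % 4 = i by omega]
  refine ⟨hH, hlen, Nat.lt_succ_self _, le_rfl, hsmall, hpow, ?_, ?_, ?_, ?_, ?_, ?_, ?_, ?_, ?_,
    ?_⟩
  · rw [hword _ (by omega)]; rfl
  · rw [hword _ (by omega)]; rfl
  · rw [hword _ (by omega)]; rfl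
  · rw [hword _ (by omega)]; rfl
  · rw [hword _ (by omega)]; rfl
  · exact fun j hj k hk => hrec j hj.le k hk 0 (by norm_num)
  · exact fun j hj k hk => hrec j hj.le k hk 1 (by norm_num)
  · exact fun j hj k hk => hrec j hj.le k hk 2 (by norm_num)
  · exact fun j hj k hk => hrec j hj k hk 3 (by norm_num)
  · intro p e he
    have hp : p < L.length := by simpa using (List.getElem?_eq_some_iff.1 he).1
    rw [hword _ (by omega)]
    simp only [content]
    rw [if_neg (by omega), if_neg (by omega), Nat.add_sub_cancel_left,
      List.getD_eq_getElem?_getD, he, Option.getD_some]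

/-! ### From intervals to points -/

/-- The hypothesis says that the entries satisfying `P` form an initial segment, whose length is
then their number. -/
theorem lt_countP_iff {α : Type*} {P : α → Bool} {l : List α}
    (hl : l.Pairwise fun a b => P b → P a) {i : ℕ} (hi : i < l.length) :
    P l[i] ↔ i < l.countP P := by
  induction l generalizing i with
  | nil => simp at hi
  | cons a l ih =>
    rw [List.pairwise_cons] at hl
    by_cases ha : P a
    · rw [List.countP_cons_of_pos ha]
      cases i with
      | zero => simpa using ha
      | succ i =>
        rw [List.getElem_cons_succ, ih hl.2, Nat.succ_lt_succ_iff]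
    · have h0 : l.countP P = 0 := List.countP_eq_zero.2 fun b hb h => ha (hl.1 b hb h)
      rw [List.countP_cons_of_neg ha, h0]
      have : ¬ P (a :: l)[i] := by
        rcases List.mem_cons.1 (List.getElem_mem hi) with h | h
        · rwa [h]
        · exact fun h' => ha (hl.1 _ h h')
      simpa using this

/-- A list of intervals with weights. -/
abbrev Intervals := List (ℝ × ℝ × ℕ)

open Classical in
/-- The total weight of the intervals contained in `[x₁, x₂]`. -/
noncomputable def weightWithin (E : Intervals) (x₁ x₂ : ℝ) : ℕ :=
  ((E.filter fun e => decide (x₁ ≤ e.1 ∧ e.2.1 ≤ x₂)).map fun e => e.2.2).sum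

open Classical in
/-- The intervals as points, the key being the rank of the right endpoint. -/
noncomputable def points (E : Intervals) : List (ℕ × ℕ) :=
  E.map fun e => (E.countP fun e' => decide (e'.2.1 < e.2.1), e.2.2)

@[simp] theorem length_points (E : Intervals) : (points E).length = E.length := by
  simp [points]

open Classical in
-- If `e.2.1 ≤ x`, then `e` itself is counted on the right but not on the left, which makes the
-- inequality strict. Equal endpoints share a rank, so ties do no harm.
theorem countP_lt_iff {E : Intervals} {e : ℝ × ℝ × ℕ} (he : e ∈ E) (x : ℝ) :
    (E.countP fun e' => decide (e'.2.1 < e.2.1)) < (E.countP fun e' => decide (e'.2.1 ≤ x)) ↔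
      e.2.1 ≤ x := by
  constructor
  · intro h
    by_contra! hx
    refine absurd h (not_lt.2 (List.countP_mono_left fun e' _ h' => ?_))
    simp only [decide_eq_true_eq] at h' ⊢
    exact h'.trans_lt hx
  · intro hx
    obtain ⟨l₁, l₂, rfl⟩ := List.append_of_mem he
    have h : ∀ l : Intervals, (l.countP fun e' => decide (e'.2.1 < e.2.1)) ≤
        l.countP fun e' => decide (e'.2.1 ≤ x) := fun l => List.countP_mono_left fun e' _ h' => by
      simp only [decide_eq_true_eq] at h' ⊢
      exact h'.le.trans hx
    have h1 := h l₁
    have h2 := h l₂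
    rw [List.countP_append, List.countP_append, List.countP_cons_of_neg (by simp),
      List.countP_cons_of_pos (by simpa using hx)]
    omega

open Classical in
theorem below_points {E : Intervals} {H : ℕ} (hH : E.length < 2 ^ H) (x : ℝ) (p : ℕ) :
    below H (E.countP fun e => decide (e.2.1 ≤ x)) (points E) p =
      (((E.take p).filter fun e => decide (e.2.1 ≤ x)).map fun e => e.2.2).sum := by
  rw [below, points, ← List.map_take, List.filter_map, List.map_map]
  congr 2
  apply List.filter_congr
  intro e he
  have he := List.mem_of_mem_take he
  have h1 : (E.countP fun e' => decide (e'.2.1 < e.2.1)) < 2 ^ H :=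
    (List.countP_le_length).trans_lt hH
  simp only [Function.comp_apply, Nat.mod_eq_of_lt h1, countP_lt_iff he]

open Classical in
-- By sortedness the intervals that begin before `x₁` are the first `c`; removing them from those
-- ending by `x₂` leaves the contained ones.
theorem sum_drop_filter {E : Intervals} (hE : E.Pairwise fun e e' => e.1 ≤ e'.1) (x₁ x₂ : ℝ) :
    (((E.take (E.countP fun e => decide (e.1 < x₁))).filter fun e => decide (e.2.1 ≤ x₂)).map
      fun e => e.2.2).sum + weightWithin E x₁ x₂ =
      ((E.filter fun e => decide (e.2.1 ≤ x₂)).map fun e => e.2.2).sum := by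
  set c := E.countP fun e => decide (e.1 < x₁)
  have hE' : E.Pairwise fun a b => decide (b.1 < x₁) → decide (a.1 < x₁) :=
    hE.imp fun h => by
      simp only [decide_eq_true_eq]
      exact h.trans_lt
  have h1 : ∀ e ∈ E.take c, e.1 < x₁ := by
    intro e he
    obtain ⟨i, hi, rfl⟩ := List.mem_take_iff_getElem.1 he
    simpa using (lt_countP_iff hE' (by omega)).2 (show i < c by omega)
  have h2 : ∀ e ∈ E.drop c, x₁ ≤ e.1 := by
    intro e he
    obtain ⟨i, hi, rfl⟩ := List.mem_drop_iff_getElem.1 he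
    have := (lt_countP_iff hE' (i := c + i) (by omega)).not.2 (show ¬ c + i < c by omega)
    simpa using this
  have h3 : weightWithin E x₁ x₂ =
      (((E.drop c).filter fun e => decide (e.2.1 ≤ x₂)).map fun e => e.2.2).sum := by
    rw [weightWithin]
    conv_lhs => rw [← List.take_append_drop c E, List.filter_append]
    have h4 : (E.take c).filter (fun e => decide (x₁ ≤ e.1 ∧ e.2.1 ≤ x₂)) = [] := by
      rw [List.filter_eq_nil_iff]
      intro e he
      have := h1 e he
      simp only [decide_eq_true_eq, not_and]
      intro h; linarith
    rw [h4, List.nil_append]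
    congr 2
    apply List.filter_congr
    intro e he
    simp [h2 e he]
  rw [h3, ← List.sum_append, ← List.map_append, ← List.filter_append, List.take_append_drop]

theorem answers_store {w H : ℕ} {E : Intervals} (hE : E.Pairwise fun e e' => e.1 ≤ e'.1)
    {S : List ℝ} (hS : S.Perm (E.map fun e => e.2.1)) (hS' : S.Pairwise (· ≤ ·))
    (hpos : 0 < E.length) (hH : 0 < H) (hlen : E.length < 2 ^ H)
    (hsmall : 4 * ((H + 1) * (E.length / H + 1) + 2) + E.length < 2 ^ w)
    (hpow : 2 ^ H < 2 ^ w) (hsum : (E.map fun e => e.2.2).sum < 2 ^ w) (x₁ x₂ : ℝ) :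
    Answers queryProg (store w H (points E) ((E.map fun e => e.1) ++ S)) x₁ x₂ (600 * H ^ 4)
      (weightWithin E x₁ x₂) := by
  classical
  have hlay := layout_store (w := w) (H := H) (L := points E) (R := (E.map fun e => e.1) ++ S) hH
    (by simpa using hlen) (by simpa using hsmall) hpow (by
      rw [points, List.map_map]
      exact hsum)
  have hSlen : S.length = E.length := by simpa using hS.length_eq
  have hc₁ : (E.countP fun e => decide (e.1 < x₁)) ≤ E.length := List.countP_le_length
  have hc₂ : (E.countP fun e => decide (e.2.1 ≤ x₂)) ≤ E.length := List.countP_le_length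
  have hE' : E.Pairwise fun a b => decide (b.1 < x₁) → decide (a.1 < x₁) :=
    hE.imp fun h => by
      simp only [decide_eq_true_eq]
      exact h.trans_lt
  have hS'' : S.Pairwise fun a b => decide (b ≤ x₂) → decide (a ≤ x₂) :=
    hS'.imp fun h => by
      simp only [decide_eq_true_eq]
      exact h.trans
  have hcS : S.countP (fun x => decide (x ≤ x₂)) = E.countP fun e => decide (e.2.1 ≤ x₂) := by
    rw [hS.countP_eq, List.countP_map]
    rfl
  refine Wp.answers ?_ ((hlay.wp_query (x₁ := x₁) (x₂ := x₂) (by simpa using hpos)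
    (c₁ := E.countP fun e => decide (e.1 < x₁)) (c₂ := E.countP fun e => decide (e.2.1 ≤ x₂))
    (by simpa using hc₁) (by simpa using hc₂) ?_ ?_).mono le_rfl fun v hv => ?_)
  · refine lt_of_le_of_lt ?_ hsum
    exact ((List.filter_sublist).map _).sum_le_sum (by simp)
  · intro i hi
    rw [length_points] at hi
    rw [← lt_countP_iff hE' hi]
    simp [store, List.getD_eq_getElem?_getD, List.getElem?_append_left, hi]
  · intro i hi
    rw [length_points] at hi ⊢
    rw [← hcS, ← lt_countP_iff hS'' (hSlen ▸ hi)]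
    simp [store, List.getD_eq_getElem?_getD, hi, hSlen]
  · rw [hv, below_points hlen, below_points hlen, length_points, List.take_length,
      ← sum_drop_filter hE x₁ x₂, Nat.add_sub_cancel_left]

/-- Intervals with weights can be stored in linear space so that the total weight of the intervals
inside a query interval is found in polylogarithmic time. -/
theorem exists_store {w : ℕ} {E : Intervals} (hE : E.Pairwise fun e e' => e.1 ≤ e'.1)
    (hw : 10 * Nat.log 2 (E.length + 2) ≤ w) (hsum : (E.map fun e => e.2.2).sum < 2 ^ w) :
    ∃ D : Store w, D.space ≤ 9600 * E.length ∧ ∀ x₁ x₂ : ℝ,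
      Answers queryProg D x₁ x₂ (9600 * Nat.log 2 (E.length + 2) ^ 4) (weightWithin E x₁ x₂) := by
  set n := E.length with hn
  set g := Nat.log 2 (n + 2) with hg
  have hg1 : 1 ≤ g := Nat.log_pos one_lt_two (by omega)
  have hlt : n + 2 < 2 ^ (g + 1) := Nat.lt_pow_succ_log_self one_lt_two _
  have hgn : g < n + 2 := Nat.log_lt_self _ (by omega)
  have hgu : g < 2 ^ g := Nat.lt_two_pow_self
  have h2w : 2 ^ (g + 6) < 2 ^ w := Nat.pow_lt_pow_right one_lt_two (by omega)
  rcases Nat.eq_zero_or_pos n with h0 | hpos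
  -- With no edges the space bound is `0`, so not even a header can be stored. Empty memory reads as
  -- length `0`, on which the program stops at once.
  · refine ⟨⟨[], []⟩, by simp [Store.space], fun x₁ x₂ => ?_⟩
    have hE0 : E = [] := List.length_eq_zero_iff.1 (hn ▸ h0)
    rw [hE0]
    have hT : 9600 * 1 ≤ 9600 * g ^ 4 := Nat.mul_le_mul_left _ (Nat.one_le_pow _ _ hg1)
    refine Wp.answers (by simp [weightWithin]) ?_
    refine Wp.comp (Wp.block (Q := fun v' => v' 0 = 0 ∧ v' 1 = 0 ∧ v' 9 = 0) ?_) (T' := 100)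
      (fun v1 ⟨h0, h1, h9⟩ => Wp.ite_eq (T := 99) (by simp [h1]) (by simp [h9]) ?_ ?_)
      (by simp only [List.length_cons, List.length_nil]; omega)
    · simp [Block, Store.word]
    · intro _
      exact (Wp.skip (v := v1) (by simp [weightWithin, h0])).mono (by norm_num) fun _ h => h
    · intro h
      exact absurd (h1.trans h9.symm) h
  · have hdm : n / (g + 1) * (g + 1) ≤ n := Nat.div_mul_le_self _ _
    have hdl : n / (g + 1) ≤ n := Nat.div_le_self _ _
    -- Linearity of the space: about `log n` levels times `n / log n` blocks.
    have hexp : (g + 1 + 1) * (n / (g + 1) + 1) =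
        n / (g + 1) * (g + 1) + n / (g + 1) + (g + 1) + 1 := by ring
    have hbound : 4 * ((g + 1 + 1) * (n / (g + 1) + 1) + 2) + n ≤ 9 * n + 4 * g + 16 := by
      rw [hexp]; omega
    have hp1 : 2 ^ (g + 1) = 2 * 2 ^ g := by ring
    have hp6 : 2 ^ (g + 6) = 64 * 2 ^ g := by ring
    refine ⟨store w (g + 1) (points E) ((E.map fun e => e.1) ++
      (E.map fun e => e.2.1).insertionSort (· ≤ ·)), ?_, fun x₁ x₂ => ?_⟩
    · simp only [Store.space, store, List.length_map, List.length_range, length_points,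
        List.length_append, List.length_insertionSort]
      rw [← hn]
      omega
    · have := answers_store (w := w) (H := g + 1) hE (List.perm_insertionSort (· ≤ ·) _)
        (List.pairwise_insertionSort (· ≤ ·) _) hpos (by omega) (by omega)
        (by rw [← hn]; omega) (by omega) hsum x₁ x₂
      obtain ⟨t, s, ht, h⟩ := this
      refine ⟨t, s, ht.trans ?_, h⟩
      -- Here `H = g + 1 ≤ 2 * g`, whence the constant `9600 = 600 * 16`.
      have h16 : (g + 1) ^ 4 ≤ (2 * g) ^ 4 := Nat.pow_le_pow_left (by omega) 4
      rw [mul_pow] at h16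
      omega

end RAM

/-! ## Cliques in an interval -/

section Cliques

open Finset

namespace SimpleGraph

variable {V : Type*}

theorem nonempty_top_iso_coe_iff [Finite V] {G : SimpleGraph V} (H : G.Subgraph) (l : ℕ) :
    Nonempty ((⊤ : SimpleGraph (Fin l)) ≃g H.coe) ↔
      H.verts.ncard = l ∧ ∀ a ∈ H.verts, ∀ b ∈ H.verts, a ≠ b → H.Adj a b := by
  have := Fintype.ofFinite V
  classical
  constructor
  · rintro ⟨f⟩
    refine ⟨?_, fun a ha b hb hab => ?_⟩
    · rw [← Nat.card_coe_set_eq, ← Nat.card_congr f.toEquiv, Nat.card_eq_fintype_card,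
        Fintype.card_fin]
    · have := (f.symm.map_adj_iff (v := ⟨a, ha⟩) (w := ⟨b, hb⟩)).1 (by
        rw [top_adj]
        exact f.symm.injective.ne (by simpa using hab))
      simpa using this
  · rintro ⟨hl, hH⟩
    have e : Fin l ≃ H.verts := by
      refine (Fintype.equivFinOfCardEq ?_).symm
      rw [← Nat.card_eq_fintype_card, Nat.card_coe_set_eq, hl]
    refine ⟨⟨e, fun {a b} => ?_⟩⟩
    rw [Subgraph.coe_adj, top_adj]
    constructor
    · intro h hab
      exact h.ne (by rw [hab])
    · intro h
      exact hH _ (e a).2 _ (e b).2 fun h' => h (e.injective (Subtype.ext h'))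

open Classical in
-- A complete subgraph is determined by its vertex set.
theorem copyCount_top [Fintype V] (G : SimpleGraph V) (l : ℕ) :
    G.copyCount (⊤ : SimpleGraph (Fin l)) = #{K : Finset V | G.IsNClique l K} := by
  rw [copyCount]
  refine card_bij (fun H _ => H.verts.toFinset) ?_ ?_ ?_
  · intro H hH
    rw [mem_filter, nonempty_top_iso_coe_iff] at hH
    rw [mem_filter, isNClique_iff, ← Set.ncard_eq_toFinset_card', Set.coe_toFinset]
    exact ⟨mem_univ _, fun a ha b hb hab => (hH.2.2 a ha b hb hab).adj_sub, hH.2.1⟩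
  · intro H hH H' hH' h
    rw [mem_filter, nonempty_top_iso_coe_iff] at hH hH'
    rw [Set.toFinset_inj] at h
    refine Subgraph.ext h ?_
    ext a b
    exact ⟨fun hab => hH'.2.2 a (h ▸ hab.fst_mem) b (h ▸ hab.snd_mem) hab.ne,
      fun hab => hH.2.2 a (h ▸ hab.fst_mem) b (h ▸ hab.snd_mem) hab.ne⟩
  · intro K hK
    rw [mem_filter, isNClique_iff] at hK
    refine ⟨(⊤ : G.Subgraph).induce K, ?_, by simp⟩
    rw [mem_filter, nonempty_top_iso_coe_iff]
    refine ⟨mem_univ _, by simpa using hK.2.2, fun a ha b hb hab => ?_⟩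
    exact ⟨ha, hb, hK.2.1 ha hb hab⟩

open Classical in
theorem card_cliques_induce [Fintype V] (G : SimpleGraph V) (S : Set V) [Fintype S]
    (l : ℕ) :
    #{K : Finset S | (G.induce S).IsNClique l K} =
      #{K : Finset V | G.IsNClique l K ∧ ∀ v ∈ K, v ∈ S} := by
  refine card_bij (fun K _ => K.map (Function.Embedding.subtype _)) ?_ ?_ ?_
  · intro K hK
    rw [mem_filter, isNClique_iff] at hK
    rw [mem_filter, isNClique_iff, card_map]
    refine ⟨mem_univ _, ⟨?_, hK.2.2⟩, ?_⟩
    · intro a ha b hb hab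
      simp only [coe_map, Set.mem_image, mem_coe] at ha hb
      obtain ⟨a, ha, rfl⟩ := ha
      obtain ⟨b, hb, rfl⟩ := hb
      exact hK.2.1 ha hb fun h => hab (by rw [h])
    · intro v hv
      obtain ⟨a, -, rfl⟩ := mem_map.1 hv
      exact a.2
  · intro K _ K' _ h
    exact Finset.map_injective _ h
  · intro K hK
    rw [mem_filter, isNClique_iff] at hK
    have h : (K.subtype (· ∈ S)).map (Function.Embedding.subtype _) = K :=
      subtype_map_of_mem hK.2.2
    refine ⟨K.subtype (· ∈ S), ?_, h⟩
    rw [mem_filter, isNClique_iff]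
    refine ⟨mem_univ _, ?_, ?_⟩
    · intro a ha b hb hab
      exact hK.2.1.1 (mem_subtype.1 ha) (mem_subtype.1 hb) fun h => hab (Subtype.ext h)
    · rw [← card_map, h, hK.2.1.2]

/-- A clique has an edge that spans the range of the attribute on it. -/
theorem IsNClique.exists_spanning_edge {G : SimpleGraph V} {l : ℕ} (hl : 2 ≤ l) {K : Finset V}
    (hK : G.IsNClique l K) (A : V → ℝ) :
    ∃ e ∈ G.edgeSet, ∀ x₁ x₂ : ℝ,
      (x₁ ≤ (e.map A).inf ∧ (e.map A).sup ≤ x₂) ↔ ∀ v ∈ K, x₁ ≤ A v ∧ A v ≤ x₂ := by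
  have hne : K.Nonempty := card_pos.1 (by rw [hK.card_eq]; omega)
  obtain ⟨u, hu, hmin⟩ := K.exists_min_image A hne
  obtain ⟨v, hv, hmax⟩ := K.exists_max_image A hne
  have key : ∃ u ∈ K, ∃ v ∈ K, u ≠ v ∧ (∀ x ∈ K, A u ≤ A x) ∧ ∀ x ∈ K, A x ≤ A v := by
    -- If one vertex is both minimal and maximal, the attribute is constant on `K`, and any second
    -- vertex serves; this uses `2 ≤ l`.
    by_cases huv : u = v
    · subst huv
      obtain ⟨b, hb, hbu⟩ := exists_mem_ne (by rw [hK.card_eq]; omega) u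
      exact ⟨u, hu, b, hb, hbu.symm, hmin, fun x hx => (hmax x hx).trans (hmin b hb)⟩
    · exact ⟨u, hu, v, hv, huv, hmin, hmax⟩
  obtain ⟨u, hu, v, hv, huv, hmin, hmax⟩ := key
  refine ⟨s(u, v), hK.isClique hu hv huv, fun x₁ x₂ => ?_⟩
  simp only [Sym2.map_mk, Sym2.inf_mk, Sym2.sup_mk, le_inf_iff, sup_le_iff]
  constructor
  · rintro ⟨⟨h1, -⟩, -, h2⟩ x hx
    exact ⟨h1.trans (hmin x hx), (hmax x hx).trans h2⟩
  · intro h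
    exact ⟨⟨(h u hu).1, (h v hv).1⟩, (h u hu).2, (h v hv).2⟩

open Classical in
-- As `l ≥ 2`, every vertex of a clique is an end of an edge, and there are at most `2m` such
-- vertices. The bound must not involve the number of vertices, since the word size depends on `m`
-- only.
theorem card_cliques_le [Fintype V] (G : SimpleGraph V) {l : ℕ} (hl : 2 ≤ l) :
    #{K : Finset V | G.IsNClique l K} ≤ (2 * #G.edgeFinset) ^ l := by
  set U := G.edgeFinset.biUnion Sym2.toFinset
  have hU : #U ≤ 2 * #G.edgeFinset := by
    rw [mul_comm]
    refine card_biUnion_le_card_mul _ _ _ fun e _ => ?_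
    rw [Sym2.card_toFinset]
    split_ifs <;> omega
  have hsub : ({K : Finset V | G.IsNClique l K} : Finset (Finset V)) ⊆ powersetCard l U := by
    intro K hK
    have hK := (mem_filter.1 hK).2
    refine mem_powersetCard.2 ⟨fun a ha => ?_, hK.card_eq⟩
    obtain ⟨b, hb, hba⟩ := exists_mem_ne (s := K) (by rw [hK.card_eq]; omega) a
    exact mem_biUnion.2 ⟨s(a, b), mem_edgeFinset.2 (hK.isClique ha hb hba.symm), by simp⟩
  calc _ ≤ #(powersetCard l U) := card_le_card hsub
    _ = (#U).choose l := card_powersetCard _ _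
    _ ≤ #U ^ l := Nat.choose_le_pow _ _
    _ ≤ _ := Nat.pow_le_pow_left hU _

end SimpleGraph

open Classical in
theorem rangeCount_top {V : Type*} [Fintype V] (G : SimpleGraph V) (A : V → ℝ) (l : ℕ)
    (x₁ x₂ : ℝ) : rangeCount G A (⊤ : SimpleGraph (Fin l)) x₁ x₂ =
      #{K : Finset V | G.IsNClique l K ∧ ∀ v ∈ K, x₁ ≤ A v ∧ A v ≤ x₂} := by
  rw [rangeCount, SimpleGraph.copyCount_top]
  convert SimpleGraph.card_cliques_induce G (rangeVerts A x₁ x₂) l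
  exact Iff.rfl

/-- The intervals spanned by the edges, with weights that count cliques. -/
theorem exists_intervals {V : Type*} [Fintype V] (G : SimpleGraph V) (A : V → ℝ) {l : ℕ}
    (hl : 2 ≤ l) :
    ∃ E : RAM.Intervals, E.length = G.edgeSet.ncard ∧ E.Pairwise (fun e e' => e.1 ≤ e'.1) ∧
      (E.map fun e => e.2.2).sum ≤ (2 * G.edgeSet.ncard) ^ l ∧
      ∀ x₁ x₂, RAM.weightWithin E x₁ x₂ = rangeCount G A (⊤ : SimpleGraph (Fin l)) x₁ x₂ := by
  classical
  have hm : G.edgeSet.ncard = #G.edgeFinset := by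
    rw [SimpleGraph.edgeFinset, Set.ncard_eq_toFinset_card']
  rcases isEmpty_or_nonempty V with hV | hV
  · have h0 : G.edgeSet = ∅ := by
      ext e
      induction e with | h a b => exact hV.elim a
    refine ⟨[], by simp [h0], .nil, by simp, fun x₁ x₂ => ?_⟩
    have h0 : RAM.weightWithin [] x₁ x₂ = 0 := by simp [RAM.weightWithin]
    rw [h0, rangeCount_top G A l x₁ x₂, eq_comm, Finset.card_eq_zero]
    refine eq_empty_of_forall_notMem fun K hK => ?_
    simp only [mem_filter, mem_univ, true_and] at hK
    have := hK.1.card_eq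
    have h1 : #K = 0 := Finset.card_eq_zero.2 (Finset.eq_empty_of_isEmpty K)
    omega
  -- Needed for `choose!`, which makes `φ` total with arbitrary values off the cliques.
  have : Nonempty (Sym2 V) := hV.map fun v => s(v, v)
  choose! φ hφ hφ' using fun (K : Finset V) (hK : G.IsNClique l K) =>
    hK.exists_spanning_edge hl A
  set c : Sym2 V → ℕ := fun e => #{K : Finset V | G.IsNClique l K ∧ φ K = e}
  set F : RAM.Intervals :=
    G.edgeFinset.toList.map fun e => ((e.map A).inf, (e.map A).sup, c e) with hF
  let r : ℝ × ℝ × ℕ → ℝ × ℝ × ℕ → Prop := fun e e' => e.1 ≤ e'.1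
  have : Std.Total r := ⟨fun a b => le_total a.1 b.1⟩
  have : IsTrans _ r := ⟨fun a b c h h' => le_trans h h'⟩
  have hperm : (F.insertionSort r).Perm F := List.perm_insertionSort r F
  have hsum : ∀ x₁ x₂, RAM.weightWithin F x₁ x₂ =
      rangeCount G A (⊤ : SimpleGraph (Fin l)) x₁ x₂ := by
    intro x₁ x₂
    rw [rangeCount_top, RAM.weightWithin, hF, List.filter_map, List.map_map]
    have h1 : ((G.edgeFinset.toList.filter ((fun e : ℝ × ℝ × ℕ => decide (x₁ ≤ e.1 ∧ e.2.1 ≤ x₂)) ∘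
        fun e => ((e.map A).inf, (e.map A).sup, c e))).map
        ((fun e => e.2.2) ∘ fun e => ((e.map A).inf, (e.map A).sup, c e))).sum =
        ∑ e ∈ G.edgeFinset with x₁ ≤ (e.map A).inf ∧ (e.map A).sup ≤ x₂, c e := by
      rw [Finset.sum, ← Multiset.sum_coe, ← Multiset.map_coe]
      congr 2
      rw [filter_val, ← coe_toList, Multiset.filter_coe]
      rfl
    -- Cliques in the range are grouped by their edge. If the interval of an edge lies in the range,
    -- so do all cliques assigned to it, so its whole weight counts.
    rw [h1, card_eq_sum_card_fiberwise (f := φ)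
      (t := {e ∈ G.edgeFinset | x₁ ≤ (e.map A).inf ∧ (e.map A).sup ≤ x₂})]
    · refine sum_congr rfl fun e he => ?_
      refine congrArg card ?_
      ext K
      simp only [mem_filter, mem_univ, true_and]
      constructor
      · rintro ⟨hK, rfl⟩
        exact ⟨⟨hK, (hφ' K hK x₁ x₂).1 (mem_filter.1 he).2⟩, rfl⟩
      · rintro ⟨⟨hK, -⟩, h⟩
        exact ⟨hK, h⟩
    · intro K hK
      simp only [mem_coe, mem_filter, mem_univ, true_and] at hK ⊢
      exact ⟨SimpleGraph.mem_edgeFinset.2 (hφ K hK.1), (hφ' K hK.1 x₁ x₂).2 hK.2⟩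
  refine ⟨F.insertionSort r, ?_, List.pairwise_insertionSort r F, ?_, fun x₁ x₂ => ?_⟩
  · rw [List.length_insertionSort, hF, List.length_map, length_toList, hm]
  · rw [(hperm.map _).sum_eq, hm]
    refine le_trans (le_of_eq ?_) (G.card_cliques_le hl)
    rw [hF, List.map_map, card_eq_sum_card_fiberwise (f := φ) (t := G.edgeFinset)]
    · rw [← sum_map_toList]
      simp only [filter_filter]
      rfl
    · intro K hK
      exact mem_coe.2 (SimpleGraph.mem_edgeFinset.2 (hφ K (mem_filter.1 hK).2))
  · rw [← hsum, RAM.weightWithin, RAM.weightWithin]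
    exact ((hperm.filter _).map _).sum_eq

end Cliques

theorem theorem3 (l : ℕ) (hl : 2 ≤ l) :
    ∃ (p : RAM.Prog) (c C k : ℕ),
      ∀ (V : Type*) [Fintype V] (G : SimpleGraph V) (A : V → ℝ) (w : ℕ),
        c * Nat.log 2 (G.edgeSet.ncard + 2) ≤ w →
        ∃ D : RAM.Store w,
          D.space ≤ C * G.edgeSet.ncard ∧
          ∀ x₁ x₂ : ℝ,
            RAM.Answers p D x₁ x₂ (C * Nat.log 2 (G.edgeSet.ncard + 2) ^ k)
              (rangeCount G A (⊤ : SimpleGraph (Fin l)) x₁ x₂) := by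
  -- The part `10` serves the addresses and keys; `3 * l` serves the clique counts, as `(g + 2) * l
  -- ≤ 3 * l * g` for `g ≥ 1`.
  refine ⟨RAM.queryProg, 3 * l + 10, 9600, 4, fun V _ G A w hw => ?_⟩
  obtain ⟨E, hlen, hE, hsum, hcount⟩ := exists_intervals G A hl
  simp only [← hcount, ← hlen] at hw hsum ⊢
  refine RAM.exists_store hE (le_trans (Nat.mul_le_mul_right _ (by omega)) hw)
    (hsum.trans_lt ?_)
  set g := Nat.log 2 (E.length + 2)
  have hg : 1 ≤ g := Nat.log_pos one_lt_two (by omega)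
  have h1 : E.length + 2 < 2 ^ (g + 1) := Nat.lt_pow_succ_log_self one_lt_two _
  have h2 : 2 * E.length ≤ 2 ^ (g + 2) := by
    rw [pow_succ]; omega
  calc (2 * E.length) ^ l ≤ (2 ^ (g + 2)) ^ l := Nat.pow_le_pow_left h2 l
    _ = 2 ^ ((g + 2) * l) := (pow_mul _ _ _).symm
    _ < 2 ^ w := Nat.pow_lt_pow_right one_lt_two (by nlinarith)
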